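/- **Setting.** Let $T,r$ be natural numbers, $\bar\mu,\bar s,\bar d\in(\mathbb N\setminus\{0\})^r$, $n=\sum_i\mu_is_id_i$, and $$\chi X(m)=\sum_{l_1\le d_1,\dots,l_r\le d_r}(-1)^{l_1+\dots+l_r}\binom{d_1}{l_1}\cdots\binom{d_r}{l_r}X\Big(m-\sum_i\mu_is_il_i\Big),\qquad \chi(e^{-i\lambda})=\prod_{j}(1-e^{-i\lambda\mu_js_j})^{d_j},$$ $$\beta(i\lambda)=\prod_{j}\ \prod_{k=-[s_j/2]}^{[s_j/2]}\Big(i\lambda-\frac{2\pi ik}{s_j}\Big)^{d_j}.$$ Define $e(k)$ and $d(k)$ by $\prod_i(1-x^{\mu_is_i})^{d_i}=\sum_ke(k)x^k$ and $\prod_i(\sum_{j\ge0}x^{\mu_is_ij})^{d_i}=\sum_kd(k)x^k$. Let $\vec\xi(m),\vec\eta(m)$, $m\in\mathbb Z$, be $T$-dimensional stochastic sequences such that $\chi\vec\xi$ is zero-mean stationary with spectral density $f$, i.e. $\mathsf E\,\chi\xi_p(m+k)\overline{\chi\xi_q(m)}=\int_{-\pi}^{\pi}e^{ik\lambda}\frac{|\chi(e^{-i\lambda})|^2}{|\beta(i\lambda)|^2}f_{pq}(\lambda)\,d\lambda$;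 $\vec\eta$ is zero-mean stationary with spectral density $g$, i.e. $\mathsf E\,\eta_p(m+k)\overline{\eta_q(m)}=\int_{-\pi}^{\pi}e^{ik\lambda}g_{pq}(\lambda)\,d\lambda$; and $\chi\vec\xi$ is uncorrelated with $\vec\eta$ (in particular if $\vec\xi$ is). Put $\vec\zeta=\vec\xi+\vec\eta$ and $p=f+|\beta(i\lambda)|^2g$, and assume that $p(\lambda)$ is invertible for almost every $\lambda$ and $$\int_{-\pi}^{\pi}\operatorname{Tr}\Big[\frac{|\beta(i\lambda)|^2}{|\chi(e^{-i\lambda})|^2}\,p(\lambda)^{-1}\Big]d\lambda<\infty .$$ Given $N\ge0$ and $\vec a(0),\dots,\vec a(N)\in\mathbb C^T$, let $\vec b(k)=\sum_{m=k}^Nd(m-k)\vec a(m)$, $A_N\vec\eta=\sum_{k=0}^N\vec a(k)^\top\vec\eta(k)$, $B_N\chi\vec\zeta=\sum_{k=0}^N\vec b(k)^\top\chi\vec\zeta(k)$, $H_N\vec\xi=B_N\chi\vec\zeta-A_N\vec\eta$, $\vec A_N(e^{i\lambda})=\sum_{k=0}^N\vec a(k)e^{ik\lambda}$ and $\vec B_N(e^{i\lambda})=\sum_{k=0}^N\vec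 b(k)e^{ik\lambda}$. The *optimal estimate* of a functional is its mean-square best approximation in the closed linear span in $L_2(\Omega)$ of the components of the observed increments $\chi\vec\zeta(k)$, $k\le-1$ or $k\ge N+n+1$. The *spectral characteristic* of an element $Y$ of the closed span of all $\chi\zeta_l(k)$ is the function $\vec h\in L_2(p)$ (unique up to a.e. equality) with $Y=\int\vec h^\top d\vec Z$, i.e. the preimage of $Y$ under the isometry of $L_2(p)$ into $L_2(\Omega)$ that maps $e^{ik\lambda}\frac{\chi(e^{-i\lambda})}{\beta(i\lambda)}\vec\delta_l$ to $\chi\zeta_l(k)$. Let $\mathbf P,\mathbf T$ be the block matrices with blocks, $0\le j,k\le N+n$, $$P_{j,k}=\frac1{2\pi}\int_{-\pi}^{\pi}e^{i\lambda(k-j)}\frac{|\beta(i\lambda)|^2}{|\chi(e^{-i\lambda})|^2}\big[p^{-1}\big]^\top d\lambda,\qquad T_{j,k}=\frac1{2\pi}\int_{-\pi}^{\pi}e^{i\lambda(k-j)}\frac{|\beta(i\lambda)|^2}{\chi(e^{-i\lambda})}\big[g\,p^{-1}\big]^\top d\lambda,$$ and let $[\mathbf a]_{+n}$, $[\mathbf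 b]_{+n}$ be the vectors $(\vec a(k))_{k\le N}$, $(\vec b(k))_{k\le N}$ followed by $n$ zero blocks. **Statement.** The integrals defining $\mathbf P$ and $\mathbf T$ converge absolutely and $\mathbf P$ is invertible. The spectral characteristic of the optimal estimate of $H_N\vec\xi$ is $$\vec h^\top=\vec B_N(e^{i\lambda})^\top\frac{\chi(e^{-i\lambda})}{\beta(i\lambda)}-\vec A_N(e^{i\lambda})^\top\overline{\beta(i\lambda)}\,g\,p^{-1}-\frac{\overline{\beta(i\lambda)}}{\overline{\chi(e^{-i\lambda})}}\Big(\sum_{k=0}^{N+n}\big(\mathbf P^{-1}[\mathbf b]_{+n}-\mathbf P^{-1}\mathbf T[\mathbf a]_{+n}\big)_ke^{ik\lambda}\Big)^\top p^{-1},$$ and $\vec h=\vec h^1-\vec h^2$, where $$(\vec h^1)^\top=\vec B_N(e^{i\lambda})^\top\frac{\chi(e^{-i\lambda})}{\beta(i\lambda)}-\frac{\overline{\beta(i\lambda)}}{\overline{\chi(e^{-i\lambda})}}\Big(\sum_{k=0}^{N+n}\big(\mathbf P^{-1}[\mathbf b]_{+n}\big)_ke^{ik\lambda}\Big)^\top p^{-1},$$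 $$(\vec h^2)^\top=\vec A_N(e^{i\lambda})^\top\overline{\beta(i\lambda)}\,g\,p^{-1}-\frac{\overline{\beta(i\lambda)}}{\overline{\chi(e^{-i\lambda})}}\Big(\sum_{k=0}^{N+n}\big(\mathbf P^{-1}\mathbf T[\mathbf a]_{+n}\big)_ke^{ik\lambda}\Big)^\top p^{-1}.$$ Here $\vec h^1$ and $\vec h^2$ are the spectral characteristics of the optimal estimates of $B_N\chi\vec\zeta$ and of $A_N\vec\eta$ respectively. Moreover, if the entries of $\frac{|\beta|^2}{|\chi|^2}g\,p^{-1}$ are integrable on $[-\pi,\pi]$ and $\mathbf T'$ has the blocks $T'_{j,k}=\frac1{2\pi}\int_{-\pi}^{\pi}e^{i\lambda(k-j)}\frac{|\beta|^2}{|\chi|^2}[g\,p^{-1}]^\top d\lambda$, then $\mathbf T[\mathbf a]_{+n}=(-1)^{d_1+\dots+d_r}\,\mathbf T'\mathbf a^{\bar\mu}$, where $\mathbf a^{\bar\mu}$ has the blocks $\vec a_{\bar\mu}(m)=\sum_{l=\max\{m-n,0\}}^{\min\{m,N\}}e(l-m+n)\,\vec a(l)$, $0\le m\le N+n$. -/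

import Mathlib

open MeasureTheory
open scoped ENNReal Matrix ComplexConjugate ComplexOrder

namespace GMInterpolation

noncomputable section

/-! ### The increment operator and its symbols

`μ` is the step vector, `s` the seasonal vector, `d` the vector of orders; a `T`-dimensional
stochastic sequence is a function `ℤ → Fin T → Ω → ℂ`. -/

/-- `n(γ) = ∑ μ_i s_i d_i`, the degree of the increment operator in the backward shift. -/
def degree {r : ℕ} (μ s d : Fin r → ℕ) : ℕ := ∑ i, μ i * s i * d i

/-- The generalized multiple increment
`∑_{l_1 ≤ d_1, …, l_r ≤ d_r} (-1)^{l_1+…+l_r} ∏ (d_i choose l_i) X_p(m - ∑ μ_i s_i l_i)`. -/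
def increment {Ω : Type*} {r T : ℕ} (μ s d : Fin r → ℕ) (X : ℤ → Fin T → Ω → ℂ)
    (m : ℤ) (p : Fin T) (ω : Ω) : ℂ :=
  ∑ l ∈ Fintype.piFinset (fun i => Finset.range (d i + 1)),
    (∏ i, (-1 : ℂ) ^ l i * ((d i).choose (l i) : ℂ)) *
      X (m - ∑ i, ((μ i * s i * l i : ℕ) : ℤ)) p ω

/-- The exponential `e^{i k λ}`. -/
def expo (k : ℤ) (lam : ℝ) : ℂ := Complex.exp (Complex.I * (k : ℂ) * (lam : ℂ))

/-- `χ(e^{-iλ}) = ∏_j (1 - e^{-iλ μ_j s_j})^{d_j}`. -/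
def chi {r : ℕ} (μ s d : Fin r → ℕ) (lam : ℝ) : ℂ :=
  ∏ j, (1 - expo (-((μ j * s j : ℕ) : ℤ)) lam) ^ d j

/-- `β(iλ) = ∏_j ∏_{k=-[s_j/2]}^{[s_j/2]} (iλ - 2πik/s_j)^{d_j}`. -/
def beta {r : ℕ} (s d : Fin r → ℕ) (lam : ℝ) : ℂ :=
  ∏ j, ∏ k ∈ Finset.Icc (-((s j / 2 : ℕ) : ℤ)) ((s j / 2 : ℕ) : ℤ),
    (Complex.I * (lam : ℂ) - 2 * (Real.pi : ℂ) * Complex.I * (k : ℂ) / (s j : ℂ)) ^ d j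

/-- The coefficients `e(k)` of `∏ (1 - x^{μ_i s_i})^{d_i} = ∑_k e(k) x^k`. -/
def eCoeff {r : ℕ} (μ s d : Fin r → ℕ) (k : ℕ) : ℂ :=
  (∏ i, ((1 : Polynomial ℂ) - Polynomial.X ^ (μ i * s i)) ^ d i).coeff k

/-- The coefficients `d(k)` of `∏_i (∑_j x^{μ_i s_i j})^{d_i} = ∑_k d(k) x^k`. -/
def dCoeff {r : ℕ} (μ s d : Fin r → ℕ) (k : ℕ) : ℂ :=
  PowerSeries.coeff k
    (∏ i, (PowerSeries.mk fun n => if μ i * s i ∣ n then (1 : ℂ) else 0) ^ d i)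

/-! ### Spectral densities -/

/-- Lebesgue measure on `[-π, π)`. -/
def freq : Measure ℝ := volume.restrict (Set.Ico (-Real.pi) Real.pi)

/-- `Y` is a zero-mean wide-sense stationary `T`-dimensional sequence with absolutely continuous
spectral function, of density `φ`:
`E Y_p(m+k) conj(Y_q(m)) = ∫_{-π}^{π} e^{ikλ} φ_{pq}(λ) dλ`. -/
structure HasSpectralDensity {Ω : Type*} [MeasurableSpace Ω] {T : ℕ} (P : Measure Ω)
    (Y : ℤ → Fin T → Ω → ℂ) (φ : ℝ → Matrix (Fin T) (Fin T) ℂ) : Prop where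
  memLp : ∀ m p, MemLp (Y m p) 2 P
  mean_zero : ∀ m p, ∫ ω, Y m p ω ∂P = 0
  posSemidef : ∀ᵐ lam ∂freq, (φ lam).PosSemidef
  integrable : ∀ p q, Integrable (fun lam => φ lam p q) freq
  covariance : ∀ (k m : ℤ) (p q : Fin T),
    ∫ ω, Y (m + k) p ω * conj (Y m q ω) ∂P = ∫ lam, expo k lam * φ lam p q ∂freq

/-- The increment sequence of `X` (zero mean) is stationary with spectral density `f` in the sense
of increment sequences: its structural function is
`∫ e^{ikλ} |χ(e^{-iλ})|² |β(iλ)|⁻² f(λ) dλ`. -/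
def HasIncrementSpectralDensity {Ω : Type*} [MeasurableSpace Ω] {r T : ℕ} (P : Measure Ω)
    (μ s d : Fin r → ℕ) (X : ℤ → Fin T → Ω → ℂ) (f : ℝ → Matrix (Fin T) (Fin T) ℂ) : Prop :=
  HasSpectralDensity P (increment μ s d X)
    (fun lam => ((‖chi μ s d lam‖ ^ 2 / ‖beta s d lam‖ ^ 2 : ℝ) : ℂ) • f lam)

/-- The increments of `ξ` are uncorrelated with `η`. -/
def IncrementsUncorrelated {Ω : Type*} [MeasurableSpace Ω] {r T : ℕ} (P : Measure Ω)
    (μ s d : Fin r → ℕ) (ξ η : ℤ → Fin T → Ω → ℂ) : Prop :=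
  ∀ (m k : ℤ) (p q : Fin T), ∫ ω, increment μ s d ξ m p ω * conj (η k q ω) ∂P = 0

/-- The spectral density `f + |β|² g` of the observed sequence `ζ = ξ + η`. -/
def obsDensity {r T : ℕ} (s d : Fin r → ℕ) (f g : ℝ → Matrix (Fin T) (Fin T) ℂ) (lam : ℝ) :
    Matrix (Fin T) (Fin T) ℂ :=
  f lam + ((‖beta s d lam‖ ^ 2 : ℝ) : ℂ) • g lam

/-- The minimality condition `∫ Tr [ |β|² |χ|⁻² (f + |β|² g)⁻¹ ] dλ < ∞`
(it presupposes that the inverse exists almost everywhere). -/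
def Minimality {r T : ℕ} (μ s d : Fin r → ℕ) (f g : ℝ → Matrix (Fin T) (Fin T) ℂ) : Prop :=
  (∀ᵐ lam ∂freq, IsUnit (obsDensity s d f g lam)) ∧
  Integrable (fun lam => Matrix.trace
    (((‖beta s d lam‖ ^ 2 / ‖chi μ s d lam‖ ^ 2 : ℝ) : ℂ) • (obsDensity s d f g lam)⁻¹)) freq

/-! ### Functionals, observations, estimates, spectral characteristics -/

/-- `b_N(k) = (D_N a_N)_k = ∑_{m=k}^{N} d(m-k) a(m)`. -/
def bCoeff {r T : ℕ} (μ s d : Fin r → ℕ) (N : ℕ) (a : ℕ → Fin T → ℂ) (k : ℕ) (p : Fin T) : ℂ :=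
  ∑ m ∈ Finset.Icc k N, dCoeff μ s d (m - k) * a m p

/-- `∑_{k=0}^{N} v(k)ᵀ Y(k)`. -/
def functional {Ω : Type*} {T : ℕ} (N : ℕ) (v : ℕ → Fin T → ℂ) (Y : ℤ → Fin T → Ω → ℂ)
    (ω : Ω) : ℂ :=
  ∑ k ∈ Finset.range (N + 1), ∑ p, v k p * Y (k : ℤ) p ω

/-- The functional `B_N χ ζ`. -/
def functionalB {Ω : Type*} {r T : ℕ} (μ s d : Fin r → ℕ) (N : ℕ) (a : ℕ → Fin T → ℂ)
    (ζ : ℤ → Fin T → Ω → ℂ) : Ω → ℂ :=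
  functional N (bCoeff μ s d N a) (increment μ s d ζ)

/-- The functional `H_N ξ = B_N χ ζ - A_N η`, with `ζ = ξ + η`. -/
def functionalH {Ω : Type*} {r T : ℕ} (μ s d : Fin r → ℕ) (N : ℕ) (a : ℕ → Fin T → ℂ)
    (ξ η : ℤ → Fin T → Ω → ℂ) : Ω → ℂ :=
  functionalB μ s d N a (ξ + η) - functional N a η

/-- The closed linear subspace of `L²(Ω)` generated by the observed increments of `ζ`, that is the
increments at the points `k ≤ -1` and `k ≥ N + n(γ) + 1`. -/
def observedSpace {Ω : Type*} [MeasurableSpace Ω] {r T : ℕ} (P : Measure Ω)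
    (μ s d : Fin r → ℕ) (N : ℕ) (ζ : ℤ → Fin T → Ω → ℂ) : Submodule ℂ (Lp ℂ 2 P) :=
  (Submodule.span ℂ {y : Lp ℂ 2 P | ∃ (k : ℤ) (p : Fin T),
    (k ≤ -1 ∨ (N : ℤ) + (degree μ s d : ℤ) + 1 ≤ k) ∧
      ⇑y =ᵐ[P] increment μ s d ζ k p}).topologicalClosure

/-- `Y` is the mean-square optimal linear estimate of `X` from the observed increments of `ζ`. -/
def IsOptimalEstimate {Ω : Type*} [MeasurableSpace Ω] {r T : ℕ} (P : Measure Ω)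
    (μ s d : Fin r → ℕ) (N : ℕ) (ζ : ℤ → Fin T → Ω → ℂ) (X : Ω → ℂ) (Y : Lp ℂ 2 P) : Prop :=
  Y ∈ observedSpace P μ s d N ζ ∧
    ∀ Z ∈ observedSpace P μ s d N ζ,
      eLpNorm (fun ω => X ω - Y ω) 2 P ≤ eLpNorm (fun ω => X ω - Z ω) 2 P

/-- The squared norm `∫ h(λ)ᵀ w(λ) conj(h(λ)) dλ` of `L₂(w)`, for a matrix weight `w`. -/
def weightedNormSq {T : ℕ} (w : ℝ → Matrix (Fin T) (Fin T) ℂ) (h : ℝ → Fin T → ℂ) : ℝ≥0∞ :=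
  ∫⁻ lam, ENNReal.ofReal (h lam ⬝ᵥ (w lam *ᵥ star (h lam))).re ∂freq

/-- `h` is the spectral characteristic of `Y`, that is `Y = ∫ h(λ)ᵀ dZ(λ)`, where `Z` is the
stochastic measure of the spectral representation
`χζ(k) = ∫ e^{ikλ} χ(e^{-iλ}) β(iλ)⁻¹ dZ(λ)`.
The integral is the isometry of `L₂(w)`, `w` the spectral density of `ζ`, into `L²(Ω)` that takes
`e^{ikλ} χ(e^{-iλ}) β(iλ)⁻¹ δ_l` to `χζ_l(k)`, extended by linearity and continuity: so `h` and `Y`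
are simultaneous limits of finite linear combinations with the same coefficients. -/
def IsSpectralCharacteristic {Ω : Type*} [MeasurableSpace Ω] {r T : ℕ} (P : Measure Ω)
    (μ s d : Fin r → ℕ) (ζ : ℤ → Fin T → Ω → ℂ) (w : ℝ → Matrix (Fin T) (Fin T) ℂ)
    (Y : Lp ℂ 2 P) (h : ℝ → Fin T → ℂ) : Prop :=
  AEMeasurable h freq ∧
  ∀ ε : ℝ≥0∞, 0 < ε → ∃ c : (ℤ × Fin T) →₀ ℂ,
    weightedNormSq w (fun lam => h lam - c.sum (fun x z =>
      Pi.single x.2 (z * expo x.1 lam * (chi μ s d lam / beta s d lam)))) < ε ∧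
    eLpNorm (fun ω => Y ω - c.sum (fun x z => z * increment μ s d ζ x.1 x.2 ω)) 2 P < ε

/-- `h` is the spectral characteristic of the optimal estimate of `X` from the observations of
`ζ = ξ + η`, where `f`, `g` are the spectral densities of `ξ`, `η`. -/
def IsOptimalSpectralCharacteristic {Ω : Type*} [MeasurableSpace Ω] {r T : ℕ} (P : Measure Ω)
    (μ s d : Fin r → ℕ) (N : ℕ) (ξ η : ℤ → Fin T → Ω → ℂ)
    (f g : ℝ → Matrix (Fin T) (Fin T) ℂ) (X : Ω → ℂ) (h : ℝ → Fin T → ℂ) : Prop :=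
  ∃ Y : Lp ℂ 2 P, IsOptimalEstimate P μ s d N (ξ + η) X Y ∧
    IsSpectralCharacteristic P μ s d (ξ + η) (obsDensity s d f g) Y h

/-! ### The matrices and the explicit formulas -/

/-- The vector `(v(0), …, v(K-1))` with `T`-dimensional blocks `v(k)`. -/
def stack {T : ℕ} (K : ℕ) (v : ℕ → Fin T → ℂ) : Fin K × Fin T → ℂ := fun x => v x.1 x.2

/-- `[v]_{+n}`: the vector `(v(0), …, v(N))` followed by `n` zero blocks. -/
def padded {T : ℕ} (N n : ℕ) (v : ℕ → Fin T → ℂ) : Fin (N + n + 1) × Fin T → ℂ :=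
  stack (N + n + 1) (fun k => if k ≤ N then v k else 0)

/-- `∑_{k<K} c(k) e^{ikλ}`, for a vector `c` of `K` blocks. -/
def trigPoly {T K : ℕ} (c : Fin K × Fin T → ℂ) (lam : ℝ) : Fin T → ℂ :=
  fun p => ∑ k : Fin K, c (k, p) * expo ((k : ℕ) : ℤ) lam

/-- The block matrix with blocks `(1/2π) ∫ e^{iλ(k-j)} φ(λ) dλ`, `0 ≤ j, k < K`. -/
def fourierMatrix {T : ℕ} (K : ℕ) (φ : ℝ → Matrix (Fin T) (Fin T) ℂ) :
    Matrix (Fin K × Fin T) (Fin K × Fin T) ℂ :=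
  Matrix.of fun x y => (1 / (2 * (Real.pi : ℂ))) *
    ∫ lam, expo (((y.1 : ℕ) : ℤ) - ((x.1 : ℕ) : ℤ)) lam * φ lam x.2 y.2 ∂freq

/-- `|β|² |χ|⁻² [(f + |β|² g)⁻¹]ᵀ`. -/
def symbolP {r T : ℕ} (μ s d : Fin r → ℕ) (f g : ℝ → Matrix (Fin T) (Fin T) ℂ) (lam : ℝ) :
    Matrix (Fin T) (Fin T) ℂ :=
  ((‖beta s d lam‖ ^ 2 / ‖chi μ s d lam‖ ^ 2 : ℝ) : ℂ) • ((obsDensity s d f g lam)⁻¹)ᵀ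

/-- `|β|² χ(e^{-iλ})⁻¹ [g (f + |β|² g)⁻¹]ᵀ`. -/
def symbolT {r T : ℕ} (μ s d : Fin r → ℕ) (f g : ℝ → Matrix (Fin T) (Fin T) ℂ) (lam : ℝ) :
    Matrix (Fin T) (Fin T) ℂ :=
  (((‖beta s d lam‖ ^ 2 : ℝ) : ℂ) / chi μ s d lam) • (g lam * (obsDensity s d f g lam)⁻¹)ᵀ

/-- `|β|² |χ|⁻² [g (f + |β|² g)⁻¹]ᵀ`. -/
def symbolT' {r T : ℕ} (μ s d : Fin r → ℕ) (f g : ℝ → Matrix (Fin T) (Fin T) ℂ) (lam : ℝ) :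
    Matrix (Fin T) (Fin T) ℂ :=
  ((‖beta s d lam‖ ^ 2 / ‖chi μ s d lam‖ ^ 2 : ℝ) : ℂ) • (g lam * (obsDensity s d f g lam)⁻¹)ᵀ

/-- The matrix `P_N`, with blocks indexed by `0, …, N + n(γ)`. -/
def matP {r T : ℕ} (μ s d : Fin r → ℕ) (N : ℕ) (f g : ℝ → Matrix (Fin T) (Fin T) ℂ) :
    Matrix (Fin (N + degree μ s d + 1) × Fin T) (Fin (N + degree μ s d + 1) × Fin T) ℂ :=
  fourierMatrix (N + degree μ s d + 1) (symbolP μ s d f g)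

/-- The matrix `T_N`, with blocks indexed by `0, …, N + n(γ)`. -/
def matT {r T : ℕ} (μ s d : Fin r → ℕ) (N : ℕ) (f g : ℝ → Matrix (Fin T) (Fin T) ℂ) :
    Matrix (Fin (N + degree μ s d + 1) × Fin T) (Fin (N + degree μ s d + 1) × Fin T) ℂ :=
  fourierMatrix (N + degree μ s d + 1) (symbolT μ s d f g)

/-- The variant `T'_N` of `T_N` with `|χ|²` in the denominator. -/
def matT' {r T : ℕ} (μ s d : Fin r → ℕ) (N : ℕ) (f g : ℝ → Matrix (Fin T) (Fin T) ℂ) :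
    Matrix (Fin (N + degree μ s d + 1) × Fin T) (Fin (N + degree μ s d + 1) × Fin T) ℂ :=
  fourierMatrix (N + degree μ s d + 1) (symbolT' μ s d f g)

/-- The blocks `a_{μ,N}(m) = ∑_{l = max(m-n,0)}^{min(m,N)} e(l-m+n) a(l)`, `0 ≤ m ≤ N + n`,
`n = n(γ)`. -/
def aMu {r T : ℕ} (μ s d : Fin r → ℕ) (N : ℕ) (a : ℕ → Fin T → ℂ) (m : ℕ) (p : Fin T) : ℂ :=
  ∑ l ∈ Finset.Icc (m - degree μ s d) (min m N), eCoeff μ s d (l + degree μ s d - m) * a l p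

/-- The coefficients `P_N⁻¹ [D_N a_N]_{+n(γ)}`. -/
def coeffC1 {r T : ℕ} (μ s d : Fin r → ℕ) (N : ℕ) (a : ℕ → Fin T → ℂ)
    (f g : ℝ → Matrix (Fin T) (Fin T) ℂ) : Fin (N + degree μ s d + 1) × Fin T → ℂ :=
  (matP μ s d N f g)⁻¹ *ᵥ padded N (degree μ s d) (bCoeff μ s d N a)

/-- The coefficients `P_N⁻¹ T_N [a_N]_{+n(γ)}`. -/
def coeffC2 {r T : ℕ} (μ s d : Fin r → ℕ) (N : ℕ) (a : ℕ → Fin T → ℂ)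
    (f g : ℝ → Matrix (Fin T) (Fin T) ℂ) : Fin (N + degree μ s d + 1) × Fin T → ℂ :=
  (matP μ s d N f g)⁻¹ *ᵥ (matT μ s d N f g *ᵥ padded N (degree μ s d) a)

/-- `(B_N(e^{iλ}))ᵀ χ(e^{-iλ}) / β(iλ)`. -/
def termB {r T : ℕ} (μ s d : Fin r → ℕ) (N : ℕ) (a : ℕ → Fin T → ℂ) (lam : ℝ) : Fin T → ℂ :=
  (chi μ s d lam / beta s d lam) • trigPoly (stack (N + 1) (bCoeff μ s d N a)) lam

/-- `(A_N(e^{iλ}))ᵀ conj(β(iλ)) g(λ) (f + |β|² g)⁻¹`. -/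
def termA {r T : ℕ} (s d : Fin r → ℕ) (N : ℕ) (a : ℕ → Fin T → ℂ)
    (f g : ℝ → Matrix (Fin T) (Fin T) ℂ) (lam : ℝ) : Fin T → ℂ :=
  conj (beta s d lam) •
    (trigPoly (stack (N + 1) a) lam ᵥ* (g lam * (obsDensity s d f g lam)⁻¹))

/-- `(conj(β(iλ)) / conj(χ(e^{-iλ}))) (∑_k c(k) e^{ikλ})ᵀ (f + |β|² g)⁻¹`. -/
def termC {r T K : ℕ} (μ s d : Fin r → ℕ) (f g : ℝ → Matrix (Fin T) (Fin T) ℂ)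
    (c : Fin K × Fin T → ℂ) (lam : ℝ) : Fin T → ℂ :=
  (conj (beta s d lam) / conj (chi μ s d lam)) • (trigPoly c lam ᵥ* (obsDensity s d f g lam)⁻¹)

/-- The function `h`, with coefficients `c = P_N⁻¹ [D_N a_N]_{+n(γ)} - P_N⁻¹ T_N [a_N]_{+n(γ)}`. -/
def charH {r T : ℕ} (μ s d : Fin r → ℕ) (N : ℕ) (a : ℕ → Fin T → ℂ)
    (f g : ℝ → Matrix (Fin T) (Fin T) ℂ) (lam : ℝ) : Fin T → ℂ :=
  termB μ s d N a lam - termA s d N a f g lam -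
    termC μ s d f g (coeffC1 μ s d N a f g - coeffC2 μ s d N a f g) lam

/-- The function `h¹`. -/
def charH1 {r T : ℕ} (μ s d : Fin r → ℕ) (N : ℕ) (a : ℕ → Fin T → ℂ)
    (f g : ℝ → Matrix (Fin T) (Fin T) ℂ) (lam : ℝ) : Fin T → ℂ :=
  termB μ s d N a lam - termC μ s d f g (coeffC1 μ s d N a f g) lam

/-- The function `h²`. -/
def charH2 {r T : ℕ} (μ s d : Fin r → ℕ) (N : ℕ) (a : ℕ → Fin T → ℂ)
    (f g : ℝ → Matrix (Fin T) (Fin T) ℂ) (lam : ℝ) : Fin T → ℂ :=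
  termA s d N a f g lam - termC μ s d f g (coeffC2 μ s d N a f g) lam

end

end GMInterpolation

/-!
# Interpolation of sequences with stationary generalized multiple increments

Everything is read off from the stationary sequence `Y = χζ`. Its spectral density is
`w = |χ|² |β|⁻² f + |χ|² g`, which is `|χ|² |β|⁻² p` almost everywhere; replacing `h` by
`u = (β / χ) h` turns `L₂(p)` into `L₂(w)`, the kernel `e^{ikλ} χ β⁻¹ δ_l` into `e^{ikλ} δ_l`, and
the minimality condition into the integrability of `tr w⁻¹`.

A random variable `X` with finite variance is represented by a function `v` in `L₂(w)` such that
`∫ e^{-ikλ} (vᵀ w)_l dλ` is its covariance with `Y_l(k)` (`IsProjectionSymbol`). Here `v = B_N` for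
`B_N χζ`, and `v = conj(χ) A_Nᵀ g w⁻¹` for `A_N η`; the latter lies in `L₂(w)` because
`|χ|² g w⁻¹ g ≤ g`. If the times `0, …, K - 1` are not observed, the characteristic `u` of the best
approximation is determined by two conditions.

* The error is orthogonal to the observations: `(v - u)ᵀ w` has Fourier coefficients only at
  `0, …, K - 1`, so `u = v - C w⁻¹` with a trigonometric polynomial `C` of these frequencies.
* The approximation lies in the closed span of the observations: the Fourier coefficients of `u` at
  `0, …, K - 1` vanish. For `u = v - C w⁻¹` this is the block Toeplitz system with matrix `P_N`,
  which is positive definite since its quadratic form is the squared `L₂(w⁻¹)` norm of `C`.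

That the second condition is sufficient is the point where analysis enters
(`exists_seq_trig_off`). Trigonometric polynomials are dense in `L₂(w)`, and by the Cauchy–Schwarz
inequality minimality makes the Fourier coefficients continuous on `L₂(w)`; hence in an
approximation of `u` the coefficients at `0, …, K - 1` tend to zero and may be deleted. The isometry
with the span of `Y` then gives `interpolation_iff`, of which the three formulas are instances.

The identity for `T_N [a_N]_{+n}` holds because the symbols of `T_N` and `T'_N` differ by the factor
`conj χ`, and `conj(χ) A_N` is, up to sign, the polynomial with coefficients `a_{μ,N}`
(`trigPoly_aMu`).
-/

namespace GMInterpolation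

open Filter Topology

/-! ### The Hermitian form of a matrix weight -/

section Forms

variable {T : ℕ}

/-- The sesquilinear form `uᵀ A conj(v)` of a matrix `A`, linear in the first argument. Its
diagonal is the integrand of `weightedNormSq`. -/
noncomputable def sesq (A : Matrix (Fin T) (Fin T) ℂ) (u v : Fin T → ℂ) : ℂ := u ⬝ᵥ (A *ᵥ star v)

variable {A : Matrix (Fin T) (Fin T) ℂ}

lemma sesq_eq_vecMul (u v : Fin T → ℂ) : sesq A u v = (u ᵥ* A) ⬝ᵥ star v :=
  Matrix.dotProduct_mulVec u A (star v)

lemma sesq_eq_sum (u v : Fin T → ℂ) : sesq A u v = ∑ i, ∑ j, u i * A i j * conj (v j) := by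
  simp [sesq, dotProduct, Matrix.mulVec, Finset.mul_sum, mul_assoc]

lemma sesq_smul_matrix (z : ℂ) (u v : Fin T → ℂ) : sesq (z • A) u v = z * sesq A u v := by
  simp [sesq, Matrix.smul_mulVec]

lemma sesq_add_matrix (B : Matrix (Fin T) (Fin T) ℂ) (u v : Fin T → ℂ) :
    sesq (A + B) u v = sesq A u v + sesq B u v := by
  simp [sesq, Matrix.add_mulVec]

lemma sesq_add_left (u u' v : Fin T → ℂ) : sesq A (u + u') v = sesq A u v + sesq A u' v := by
  simp [sesq]

lemma sesq_sub_left (u u' v : Fin T → ℂ) : sesq A (u - u') v = sesq A u v - sesq A u' v := by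
  simp [sesq]

lemma sesq_smul_left (z : ℂ) (u v : Fin T → ℂ) : sesq A (z • u) v = z * sesq A u v := by
  simp [sesq]

lemma sesq_add_right (u v v' : Fin T → ℂ) : sesq A u (v + v') = sesq A u v + sesq A u v' := by
  simp [sesq, Matrix.mulVec_add]

lemma sesq_sub_right (u v v' : Fin T → ℂ) : sesq A u (v - v') = sesq A u v - sesq A u v' := by
  simp [sesq, Matrix.mulVec_sub]

lemma sesq_smul_right (z : ℂ) (u v : Fin T → ℂ) : sesq A u (z • v) = conj z * sesq A u v := by
  simp [sesq, Matrix.mulVec_smul]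

lemma conj_sesq (hA : A.IsHermitian) (u v : Fin T → ℂ) : conj (sesq A u v) = sesq A v u := by
  simp only [sesq_eq_sum, map_sum, map_mul, Complex.conj_conj]
  rw [Finset.sum_comm]
  refine Finset.sum_congr rfl fun i _ => Finset.sum_congr rfl fun j _ => ?_
  rw [← hA.apply i j]
  simp only [RCLike.star_def]
  ring

lemma sesq_self_nonneg (hA : A.PosSemidef) (u : Fin T → ℂ) : 0 ≤ (sesq A u u).re := by
  have := hA.dotProduct_mulVec_nonneg (star u)
  rw [star_star] at this
  exact (Complex.le_def.1 this).1

lemma sesq_self_pos (hA : A.PosDef) {u : Fin T → ℂ} (hu : u ≠ 0) : 0 < (sesq A u u).re := by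
  have := hA.dotProduct_mulVec_pos (x := star u) (by simpa using hu)
  rw [star_star] at this
  exact (Complex.lt_def.1 this).1

lemma sesq_self_im (hA : A.IsHermitian) (u : Fin T → ℂ) : (sesq A u u).im = 0 :=
  Complex.conj_eq_iff_im.1 (conj_sesq hA u u)

lemma re_sesq_sub_self (hA : A.IsHermitian) (u v : Fin T → ℂ) :
    (sesq A (u - v) (u - v)).re =
      (sesq A u u).re + (sesq A v v).re - 2 * (sesq A u v).re := by
  have h : (sesq A v u).re = (sesq A u v).re := by rw [← conj_sesq hA u v, Complex.conj_re]
  simp only [sesq_sub_left, sesq_sub_right, Complex.sub_re, h]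
  ring

lemma re_sesq_add_self (hA : A.IsHermitian) (u v : Fin T → ℂ) :
    (sesq A (u + v) (u + v)).re =
      (sesq A u u).re + (sesq A v v).re + 2 * (sesq A u v).re := by
  have h : (sesq A v u).re = (sesq A u v).re := by rw [← conj_sesq hA u v, Complex.conj_re]
  simp only [sesq_add_left, sesq_add_right, Complex.add_re, h]
  ring

lemma re_sesq_sub_self_le (hA : A.PosSemidef) (u v : Fin T → ℂ) :
    (sesq A (u - v) (u - v)).re ≤ 2 * (sesq A u u).re + 2 * (sesq A v v).re := by
  have h1 := re_sesq_sub_self hA.1 u v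
  have h2 := re_sesq_add_self hA.1 u v
  have h3 := sesq_self_nonneg hA (u + v)
  linarith

/-- The Cauchy–Schwarz inequality, in the additive form that survives integration directly. -/
lemma norm_sesq_le (hA : A.PosSemidef) (u v : Fin T → ℂ) {δ : ℝ} (hδ : 0 < δ) :
    ‖sesq A u v‖ ≤ δ⁻¹ * (sesq A u u).re + δ * (sesq A v v).re := by
  obtain ⟨z, hz, hzs⟩ : ∃ z : ℂ, ‖z‖ = 1 ∧ conj z * sesq A u v = ‖sesq A u v‖ := by
    obtain ⟨c, hc, h⟩ := RCLike.exists_norm_eq_mul_self (sesq A u v)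
    exact ⟨conj c, by simpa using hc, by simpa using h.symm⟩
  -- The form is nonnegative at `u - δ z v`, where the phase `z` makes the cross term real.
  have h0 := sesq_self_nonneg hA (u - ((δ : ℂ) * z) • v)
  rw [re_sesq_sub_self hA.1] at h0
  have h1 : sesq A u (((δ : ℂ) * z) • v) = (δ * ‖sesq A u v‖ : ℝ) := by
    rw [sesq_smul_right, map_mul, Complex.conj_ofReal, mul_assoc, hzs]
    push_cast; rfl
  have h2 : sesq A (((δ : ℂ) * z) • v) (((δ : ℂ) * z) • v) = ((δ ^ 2 : ℝ) : ℂ) * sesq A v v := by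
    rw [sesq_smul_left, sesq_smul_right, ← mul_assoc, Complex.mul_conj, Complex.normSq_mul,
      Complex.normSq_eq_norm_sq, Complex.normSq_eq_norm_sq, hz]
    simp
  rw [h1, h2, Complex.re_ofReal_mul, Complex.ofReal_re] at h0
  have h3 : 0 ≤ δ⁻¹ * (sesq A u u).re := mul_nonneg (by positivity) (sesq_self_nonneg hA u)
  have h4 : 0 ≤ δ * (sesq A v v).re := mul_nonneg hδ.le (sesq_self_nonneg hA v)
  have h5 : 0 ≤ δ⁻¹ * ((sesq A u u).re + δ ^ 2 * (sesq A v v).re - 2 * (δ * ‖sesq A u v‖)) :=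
    mul_nonneg (by positivity) h0
  have h6 : δ⁻¹ * ((sesq A u u).re + δ ^ 2 * (sesq A v v).re - 2 * (δ * ‖sesq A u v‖))
      = δ⁻¹ * (sesq A u u).re + δ * (sesq A v v).re - 2 * ‖sesq A u v‖ := by
    field_simp
  rw [h6] at h5
  linarith [norm_nonneg (sesq A u v)]

lemma sesq_single_right (u : Fin T → ℂ) (l : Fin T) :
    sesq A u (Pi.single l 1) = (u ᵥ* A) l := by
  rw [sesq_eq_vecMul]
  simp [dotProduct, Pi.single_apply, apply_ite]

lemma sesq_single_single (l : Fin T) :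
    sesq A (Pi.single l 1) (Pi.single l 1) = A l l := by
  simp [sesq_single_right]

lemma norm_vecMul_apply_le (hA : A.PosSemidef) (u : Fin T → ℂ) (l : Fin T) {δ : ℝ} (hδ : 0 < δ) :
    ‖(u ᵥ* A) l‖ ≤ δ⁻¹ * (sesq A u u).re + δ * (A l l).re := by
  simpa [sesq_single_right] using norm_sesq_le hA u (Pi.single l 1) hδ

/-- Evaluation of a coordinate is bounded on the Hermitian space of `A`, its norm being controlled
by `A⁻¹`: it is the form against the `l`-th row of `A⁻¹`. -/
lemma norm_apply_le (hA : A.PosDef) (u : Fin T → ℂ) (l : Fin T) {δ : ℝ} (hδ : 0 < δ) :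
    ‖u l‖ ≤ δ⁻¹ * (sesq A u u).re + δ * (A⁻¹.trace).re := by
  have hdet : IsUnit A.det := (Matrix.isUnit_iff_isUnit_det A).1 hA.isUnit
  have key : ∀ x, sesq A x (Pi.single l 1 ᵥ* A⁻¹) = x l := by
    intro x
    have : star (Pi.single l (1 : ℂ) ᵥ* A⁻¹) = A⁻¹ *ᵥ (Pi.single l (1 : ℂ)) := by
      rw [Matrix.star_vecMul, hA.inv.1.eq]
      congr 1
      ext i
      simp [Pi.single_apply, apply_ite]
    rw [sesq, this, Matrix.mulVec_mulVec, Matrix.mul_nonsing_inv _ hdet, Matrix.one_mulVec,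
      dotProduct_single_one]
  have h := norm_sesq_le hA.posSemidef u (Pi.single l 1 ᵥ* A⁻¹) hδ
  rw [key, key] at h
  have hdiag : ∀ i, 0 ≤ (A⁻¹ i i).re := fun i =>
    (Complex.le_def.1 (hA.inv.posSemidef.diag_nonneg (i := i))).1
  have htr : ((Pi.single l 1 ᵥ* A⁻¹) l).re ≤ (A⁻¹.trace).re := by
    rw [Matrix.single_one_vecMul, Matrix.trace, Complex.re_sum]
    exact Finset.single_le_sum (f := fun i => (A⁻¹ i i).re) (fun i _ => hdiag i)
      (Finset.mem_univ l)
  linarith [mul_le_mul_of_nonneg_left htr hδ.le]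

lemma re_sesq_self_le (u : Fin T → ℂ) :
    (sesq A u u).re ≤ (∑ i, ∑ j, ‖A i j‖) * ∑ l, ‖u l‖ ^ 2 := by
  have hle : ∀ i, ‖u i‖ ^ 2 ≤ ∑ l, ‖u l‖ ^ 2 := fun i =>
    Finset.single_le_sum (f := fun l => ‖u l‖ ^ 2) (fun _ _ => by positivity) (Finset.mem_univ i)
  rw [sesq_eq_sum, Complex.re_sum, Finset.sum_mul]
  refine Finset.sum_le_sum fun i _ => ?_
  rw [Complex.re_sum, Finset.sum_mul]
  refine Finset.sum_le_sum fun j _ => ?_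
  refine (Complex.re_le_norm _).trans ?_
  rw [norm_mul, norm_mul, RCLike.norm_conj]
  have : ‖u i‖ * ‖u j‖ ≤ ∑ l, ‖u l‖ ^ 2 := by
    nlinarith [hle i, hle j, sq_nonneg (‖u i‖ - ‖u j‖)]
  nlinarith [norm_nonneg (A i j)]

lemma norm_entry_le_of_posSemidef (hA : A.PosSemidef) (i j : Fin T) :
    ‖A i j‖ ≤ (A.trace).re + (A.trace).re := by
  have hdiag : ∀ i, 0 ≤ (A i i).re := fun i => (Complex.le_def.1 (hA.diag_nonneg (i := i))).1
  have hle : ∀ i, (A i i).re ≤ (A.trace).re := fun i => by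
    simp only [Matrix.trace, Matrix.diag, Complex.re_sum]
    exact Finset.single_le_sum (f := fun i => (A i i).re) (fun i _ => hdiag i) (Finset.mem_univ i)
  have h := norm_vecMul_apply_le hA (Pi.single i 1) j one_pos
  rw [sesq_single_single, Matrix.single_one_vecMul] at h
  simp only [inv_one, one_mul] at h
  exact h.trans (add_le_add (hle i) (hle j))

/-- If `0 ≤ G`, `b > 0` and `b G ≤ A` then `b G A⁻¹ G ≤ G`. -/
lemma re_sesq_mul_inv_le {F G : Matrix (Fin T) (Fin T) ℂ} {b : ℝ} (hb : 0 < b) (hF : F.PosSemidef)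
    (hG : G.PosSemidef) (hA : (F + (b : ℂ) • G).PosDef) (x : Fin T → ℂ) :
    b * (sesq (F + (b : ℂ) • G) (x ᵥ* (G * (F + (b : ℂ) • G)⁻¹))
      (x ᵥ* (G * (F + (b : ℂ) • G)⁻¹))).re ≤ (sesq G x x).re := by
  set A := F + (b : ℂ) • G with hAdef
  set y := x ᵥ* (G * A⁻¹) with hy
  have hdet : IsUnit A.det := (Matrix.isUnit_iff_isUnit_det A).1 hA.isUnit
  have hyA : y ᵥ* A = x ᵥ* G := by
    rw [hy, Matrix.vecMul_vecMul, Matrix.mul_assoc, Matrix.nonsing_inv_mul _ hdet, Matrix.mul_one]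
  have h1 : sesq A y y = sesq G x y := by rw [sesq_eq_vecMul, hyA, ← sesq_eq_vecMul]
  have h2 : (sesq A y y).re = (sesq F y y).re + b * (sesq G y y).re := by
    rw [hAdef, sesq_add_matrix, sesq_smul_matrix, Complex.add_re, Complex.re_ofReal_mul]
  -- Expand `0 ≤ G[x - b y]` and use `b G[y] ≤ A[y] = G[x, y]`.
  have h3 := sesq_self_nonneg hG (x - (b : ℂ) • y)
  rw [re_sesq_sub_self hG.1, sesq_smul_right, sesq_smul_left, sesq_smul_right, Complex.conj_ofReal,
    Complex.re_ofReal_mul, Complex.re_ofReal_mul, Complex.re_ofReal_mul, ← h1] at h3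
  have h4 := sesq_self_nonneg hF y
  have h5 : b * (b * (sesq G y y).re) ≤ b * (sesq A y y).re := by gcongr; linarith
  linarith

end Forms

/-! ### Exponentials and trigonometric polynomials -/

instance isFiniteMeasure_freq : IsFiniteMeasure freq := by
  unfold freq; infer_instance

lemma expo_zero (lam : ℝ) : expo 0 lam = 1 := by simp [expo]

lemma expo_add (j k : ℤ) (lam : ℝ) : expo (j + k) lam = expo j lam * expo k lam := by
  rw [expo, expo, expo, ← Complex.exp_add]
  push_cast
  ring_nf

lemma conj_expo (k : ℤ) (lam : ℝ) : conj (expo k lam) = expo (-k) lam := by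
  rw [expo, expo, ← Complex.exp_conj]
  simp

lemma norm_expo (k : ℤ) (lam : ℝ) : ‖expo k lam‖ = 1 := by
  have : Complex.I * (k : ℂ) * (lam : ℂ) = ((k * lam : ℝ) : ℂ) * Complex.I := by
    push_cast; ring
  rw [expo, this, Complex.norm_exp_ofReal_mul_I]

@[fun_prop]
lemma continuous_expo (k : ℤ) : Continuous (expo k) := by
  unfold expo; fun_prop

lemma expo_natCast_mul (m k : ℕ) (lam : ℝ) : expo (-((m * k : ℕ) : ℤ)) lam =
    expo (-(m : ℤ)) lam ^ k := by
  rw [expo, expo, ← Complex.exp_nat_mul]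
  push_cast
  ring_nf

lemma fourier_coe_eq_expo (k : ℤ) (lam : ℝ) :
    fourier k (lam : AddCircle (2 * Real.pi)) = expo k lam := by
  rw [fourier_coe_apply, expo]
  have : (Real.pi : ℂ) ≠ 0 := by exact_mod_cast Real.pi_ne_zero
  congr 1
  push_cast
  field_simp

lemma integral_expo (k : ℤ) : ∫ lam, expo k lam ∂freq = if k = 0 then 2 * (Real.pi : ℂ) else 0 := by
  rw [freq, integral_Ico_eq_integral_Ioo, ← integral_Ioc_eq_integral_Ioo,
    ← intervalIntegral.integral_of_le (by linarith [Real.pi_pos])]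
  split_ifs with hk
  · subst hk
    simp only [expo_zero, intervalIntegral.integral_const]
    rw [Complex.real_smul]
    push_cast; ring
  · have hk' : Complex.I * (k : ℂ) ≠ 0 := mul_ne_zero Complex.I_ne_zero (by exact_mod_cast hk)
    simp only [expo]
    rw [integral_exp_mul_complex hk', div_eq_zero_iff]
    left
    rw [sub_eq_zero, Complex.exp_eq_exp_iff_exists_int]
    exact ⟨k, by push_cast; ring⟩

section Trig

variable {T : ℕ}

/-- The vector trigonometric polynomial `∑ c(k, l) e^{ikλ} δ_l` with finitely supported
coefficients, as a linear map of the coefficients. -/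
noncomputable def trig : ((ℤ × Fin T) →₀ ℂ) →ₗ[ℂ] (ℝ → Fin T → ℂ) :=
  Finsupp.linearCombination ℂ fun x lam => Pi.single x.2 (expo x.1 lam)

lemma trig_apply (c : (ℤ × Fin T) →₀ ℂ) (lam : ℝ) :
    trig c lam = c.sum fun x z => Pi.single x.2 (z * expo x.1 lam) := by
  simp only [trig, Finsupp.linearCombination_apply, Finsupp.sum, Finset.sum_apply, Pi.smul_apply]
  refine Finset.sum_congr rfl fun x _ => ?_
  rw [← Pi.single_smul, smul_eq_mul]

lemma trig_single (x : ℤ × Fin T) (z : ℂ) (lam : ℝ) :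
    trig (Finsupp.single x z) lam = Pi.single x.2 (z * expo x.1 lam) := by
  rw [trig_apply, Finsupp.sum_single_index (by simp)]

lemma continuous_trig (c : (ℤ × Fin T) →₀ ℂ) : Continuous (trig c) := by
  have : trig c = fun lam => ∑ x ∈ c.support, Pi.single x.2 (c x * expo x.1 lam) :=
    funext fun lam => trig_apply c lam
  rw [this]
  refine continuous_finsetSum _ fun x _ => ?_
  exact (continuous_single x.2).comp (continuous_const.mul (continuous_expo _))

lemma trig_apply_apply (c : (ℤ × Fin T) →₀ ℂ) (lam : ℝ) (l : Fin T) :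
    trig c lam l = ∑ x ∈ c.support, if x.2 = l then c x * expo x.1 lam else 0 := by
  rw [trig_apply, Finsupp.sum, Finset.sum_apply]
  refine Finset.sum_congr rfl fun x _ => ?_
  rw [Pi.single_apply]
  simp only [eq_comm]

lemma norm_trig_apply_le (c : (ℤ × Fin T) →₀ ℂ) (lam : ℝ) (l : Fin T) :
    ‖trig c lam l‖ ≤ ∑ x ∈ c.support, ‖c x‖ := by
  rw [trig_apply_apply]
  refine (norm_sum_le _ _).trans (Finset.sum_le_sum fun x _ => ?_)
  split_ifs
  · rw [norm_mul, norm_expo, mul_one]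
  · simp

/-- The Fourier coefficients of a trigonometric polynomial are its coefficients. -/
lemma integral_expo_mul_trig (c : (ℤ × Fin T) →₀ ℂ) (k : ℤ) (l : Fin T) :
    ∫ lam, expo (-k) lam * trig c lam l ∂freq = 2 * (Real.pi : ℂ) * c (k, l) := by
  induction c using Finsupp.induction_linear with
  | zero => simp
  | add c c' h h' =>
    have hi : ∀ b : (ℤ × Fin T) →₀ ℂ,
        Integrable (fun lam => expo (-k) lam * trig b lam l) freq := by
      intro b
      refine Integrable.of_bound (C := ∑ x ∈ b.support, ‖b x‖) ?_ (Filter.Eventually.of_forall ?_)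
      · exact ((continuous_expo _).mul
          ((continuous_apply l).comp (continuous_trig b))).aestronglyMeasurable
      · intro lam
        rw [norm_mul, norm_expo, one_mul]
        exact norm_trig_apply_le b lam l
    simp only [map_add, Pi.add_apply, mul_add, Finsupp.add_apply]
    rw [integral_add (hi c) (hi c'), h, h']
  | single x z =>
    obtain ⟨j, q⟩ := x
    simp only [trig_single, Finsupp.single_apply, Prod.mk.injEq, Pi.single_apply]
    by_cases hq : l = q
    · subst hq
      simp only [if_true, and_true]
      have : ∀ lam, expo (-k) lam * (z * expo j lam) = z * expo (j - k) lam := by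
        intro lam; rw [sub_eq_add_neg, expo_add]; ring
      simp only [this, integral_const_mul, integral_expo, sub_eq_zero]
      split_ifs <;> ring
    · simp [hq, Ne.symm hq]

end Trig

/-! ### Density of the trigonometric polynomials -/

/-- Trigonometric polynomials approximate bounded functions in `L²` of any finite measure with a
density on `[-π, π)`: continuous functions on the circle do, and trigonometric polynomials are
uniformly dense in these. -/
lemma exists_trig_approx_scalar {W : ℝ → ℝ} (hW : Integrable W freq) {φ : ℝ → ℂ}
    (hφ : Measurable φ) {C : ℝ} (hC : ∀ x, ‖φ x‖ ≤ C) {ε : ℝ≥0∞} (hε : 0 < ε) :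
    ∃ c : ℤ →₀ ℂ, ∫⁻ lam, ENNReal.ofReal (W lam) *
      ‖φ lam - c.sum fun k z => z * expo k lam‖ₑ ^ 2 ∂freq < ε := by
  have : Fact (0 < 2 * Real.pi) := ⟨by positivity⟩
  set ν := freq.withDensity fun lam => ENNReal.ofReal (W lam) with hν
  have : IsFiniteMeasure ν := isFiniteMeasure_withDensity_ofReal hW.2
  set π' : ℝ → AddCircle (2 * Real.pi) := fun x => (x : AddCircle (2 * Real.pi)) with hπ'
  have hπm : Measurable π' := AddCircle.measurable_mk'
  set ν' := ν.map π' with hν'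
  have : IsFiniteMeasure ν' := Measure.isFiniteMeasure_map ν π'
  set φ' : AddCircle (2 * Real.pi) → ℂ :=
    fun x => φ (AddCircle.measurableEquivIco (2 * Real.pi) (-Real.pi) x) with hφ'
  have hφ'm : Measurable φ' :=
    hφ.comp (measurable_subtype_coe.comp (AddCircle.measurableEquivIco _ _).measurable)
  have hφ'L : MemLp φ' 2 ν' :=
    MemLp.of_bound hφ'm.aestronglyMeasurable C (Filter.Eventually.of_forall fun x => hC _)
  have hdense := (ContinuousMap.toLp_denseRange ℂ ν' ℂ
    (p := 2) (by simp)).topologicalClosure_map_submodule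
    (span_fourier_closure_eq_top (T := 2 * Real.pi))
  have hmem : hφ'L.toLp φ' ∈ closure (((Submodule.span ℂ (Set.range (@fourier (2 * Real.pi)))).map
      (ContinuousMap.toLp (E := ℂ) 2 ν' ℂ).toLinearMap : Submodule ℂ (Lp ℂ 2 ν')) :
      Set (Lp ℂ 2 ν')) := by
    rw [← Submodule.topologicalClosure_coe, hdense]; trivial
  have hε' : 0 < min ε 1 := lt_min hε one_pos
  obtain ⟨G, ⟨g, hg, rfl⟩, hG⟩ := EMetric.mem_closure_iff.1 hmem _ hε'
  obtain ⟨c, hc⟩ := Finsupp.mem_span_range_iff_exists_finsupp.1 hg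
  refine ⟨c, ?_⟩
  have hgval : ∀ lam : ℝ, g (π' lam) = c.sum fun k z => z * expo k lam := by
    intro lam
    rw [← hc, Finsupp.sum, ContinuousMap.sum_apply]
    exact Finset.sum_congr rfl fun k _ => by
      rw [ContinuousMap.smul_apply, fourier_coe_eq_expo, smul_eq_mul]
  have h1 : eLpNorm (φ' - ⇑g) 2 ν' < min ε 1 := by
    rw [Lp.edist_def] at hG
    refine lt_of_eq_of_lt (eLpNorm_congr_ae ?_) hG
    exact (hφ'L.coeFn_toLp.symm).sub (ContinuousMap.coeFn_toLp ν' g).symm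
  have h2 : ∫⁻ x, ‖φ' x - g x‖ₑ ^ 2 ∂ν' = eLpNorm (φ' - ⇑g) 2 ν' ^ 2 := by
    have := eLpNorm_nnreal_pow_eq_lintegral (μ := ν') (f := φ' - ⇑g) (p := 2) (by norm_num)
    simpa using this.symm
  have h3 : ∫⁻ x, ‖φ' x - g x‖ₑ ^ 2 ∂ν' < ε := by
    rw [h2, sq]
    calc eLpNorm (φ' - ⇑g) 2 ν' * eLpNorm (φ' - ⇑g) 2 ν' ≤ eLpNorm (φ' - ⇑g) 2 ν' * 1 := by
          gcongr; exact (h1.trans_le (min_le_right _ _)).le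
      _ < ε := by rw [mul_one]; exact h1.trans_le (min_le_left _ _)
  refine lt_of_eq_of_lt ?_ h3
  have hgm : Measurable fun x => ‖φ' x - g x‖ₑ ^ 2 :=
    ((hφ'm.sub g.continuous.measurable).enorm).pow_const 2
  rw [hν', lintegral_map hgm hπm, hν]
  refine Eq.trans ?_ (lintegral_withDensity_eq_lintegral_mul₀
    hW.1.aemeasurable.ennreal_ofReal (hgm.comp hπm).aemeasurable).symm
  refine lintegral_congr_ae ?_
  have hIco : ∀ᵐ lam ∂freq, lam ∈ Set.Ico (-Real.pi) Real.pi :=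
    ae_restrict_mem measurableSet_Ico
  filter_upwards [hIco] with lam hlam
  have : φ' (π' lam) = φ lam := by
    have hmem : lam ∈ Set.Ico (-Real.pi) (-Real.pi + 2 * Real.pi) := by
      convert hlam using 2; ring
    have h := AddCircle.equivIco_coe_of_mem (p := 2 * Real.pi) (a := -Real.pi) hmem
    simp only [hφ']
    exact congrArg φ h
  simp only [Pi.mul_apply, Function.comp]
  rw [this, hgval]

/-! ### The weighted space of a spectral density -/

section Weighted

variable {T : ℕ} {w : ℝ → Matrix (Fin T) (Fin T) ℂ}

lemma aemeasurable_sesq (hw : ∀ p q, AEMeasurable (fun lam => w lam p q) freq)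
    {u v : ℝ → Fin T → ℂ} (hu : AEMeasurable u freq) (hv : AEMeasurable v freq) :
    AEMeasurable (fun lam => sesq (w lam) (u lam) (v lam)) freq := by
  simp only [sesq_eq_sum]
  refine Finset.aemeasurable_fun_sum _ fun i _ => Finset.aemeasurable_fun_sum _ fun j _ => ?_
  exact ((aemeasurable_pi_iff.1 hu i).mul (hw i j)).mul
    (Complex.continuous_conj.measurable.comp_aemeasurable (aemeasurable_pi_iff.1 hv j))

lemma aemeasurable_vecMul (hw : ∀ p q, AEMeasurable (fun lam => w lam p q) freq)
    {u : ℝ → Fin T → ℂ} (hu : AEMeasurable u freq) :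
    AEMeasurable (fun lam => u lam ᵥ* w lam) freq := by
  refine aemeasurable_pi_iff.2 fun l => ?_
  simp only [Matrix.vecMul, dotProduct]
  exact Finset.aemeasurable_fun_sum _ fun i _ => (aemeasurable_pi_iff.1 hu i).mul (hw i l)

lemma weightedNormSq_eq_lintegral_sesq (w : ℝ → Matrix (Fin T) (Fin T) ℂ) (u : ℝ → Fin T → ℂ) :
    weightedNormSq w u = ∫⁻ lam, ENNReal.ofReal (sesq (w lam) (u lam) (u lam)).re ∂freq := rfl

lemma weightedNormSq_congr {u v : ℝ → Fin T → ℂ} (h : u =ᵐ[freq] v) :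
    weightedNormSq w u = weightedNormSq w v :=
  lintegral_congr_ae (h.mono fun lam hlam => by simp only [hlam])

lemma weightedNormSq_sub_le (hw : ∀ p q, AEMeasurable (fun lam => w lam p q) freq)
    (hpos : ∀ᵐ lam ∂freq, (w lam).PosSemidef) {u v : ℝ → Fin T → ℂ} (hu : AEMeasurable u freq) :
    weightedNormSq w (u - v) ≤ 2 * weightedNormSq w u + 2 * weightedNormSq w v := by
  simp only [weightedNormSq_eq_lintegral_sesq]
  have hm : AEMeasurable (fun lam => ENNReal.ofReal (sesq (w lam) (u lam) (u lam)).re) freq :=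
    (Complex.measurable_re.comp_aemeasurable (aemeasurable_sesq hw hu hu)).ennreal_ofReal
  rw [← lintegral_const_mul' _ _ (by simp), ← lintegral_const_mul' _ _ (by simp),
    ← lintegral_add_left' (hm.const_mul 2)]
  refine lintegral_mono_ae ?_
  filter_upwards [hpos] with lam hlam
  have h := re_sesq_sub_self_le hlam (u lam) (v lam)
  have hu0 := sesq_self_nonneg hlam (u lam)
  have hv0 := sesq_self_nonneg hlam (v lam)
  have h2 : (2 : ℝ≥0∞) = ENNReal.ofReal 2 := by simp
  rw [h2, ← ENNReal.ofReal_mul (by norm_num), ← ENNReal.ofReal_mul (by norm_num),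
    ← ENNReal.ofReal_add (by positivity) (by positivity)]
  exact ENNReal.ofReal_le_ofReal h

lemma ae_eq_of_weightedNormSq_sub_eq_zero (hw : ∀ p q, AEMeasurable (fun lam => w lam p q) freq)
    (hpos : ∀ᵐ lam ∂freq, (w lam).PosDef) {u v : ℝ → Fin T → ℂ} (hu : AEMeasurable u freq)
    (hv : AEMeasurable v freq) (h : weightedNormSq w (u - v) = 0) : u =ᵐ[freq] v := by
  have hm : AEMeasurable (fun lam => ENNReal.ofReal
      (sesq (w lam) ((u - v) lam) ((u - v) lam)).re) freq :=
    (Complex.measurable_re.comp_aemeasurable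
      (aemeasurable_sesq hw (hu.sub hv) (hu.sub hv))).ennreal_ofReal
  rw [weightedNormSq_eq_lintegral_sesq, lintegral_eq_zero_iff' hm] at h
  filter_upwards [h, hpos] with lam h0 hlam
  by_contra hne
  have := sesq_self_pos hlam (u := (u - v) lam) (sub_ne_zero.2 hne)
  simp only [Pi.zero_apply, ENNReal.ofReal_eq_zero] at h0
  linarith

lemma weightedNormSq_le_sum (u : ℝ → Fin T → ℂ)
    (hw : ∀ p q, AEMeasurable (fun lam => w lam p q) freq) (hu : AEMeasurable u freq) :
    weightedNormSq w u ≤ ∑ l, ∫⁻ lam, ENNReal.ofReal (∑ i, ∑ j, ‖w lam i j‖) *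
      ‖u lam l‖ₑ ^ 2 ∂freq := by
  have hW : AEMeasurable (fun lam => ENNReal.ofReal (∑ i, ∑ j, ‖w lam i j‖)) freq :=
    (Finset.aemeasurable_fun_sum _ fun i _ => Finset.aemeasurable_fun_sum _ fun j _ =>
      (hw i j).norm).ennreal_ofReal
  rw [weightedNormSq_eq_lintegral_sesq]
  refine le_of_le_of_eq (lintegral_mono fun lam => ?_) (lintegral_finsetSum' Finset.univ
    fun l _ => hW.mul ((aemeasurable_pi_iff.1 hu l).enorm.pow_const 2))
  have hnn : 0 ≤ ∑ i, ∑ j, ‖w lam i j‖ :=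
    Finset.sum_nonneg fun i _ => Finset.sum_nonneg fun j _ => norm_nonneg _
  refine (ENNReal.ofReal_le_ofReal (re_sesq_self_le (u lam))).trans (le_of_eq ?_)
  rw [ENNReal.ofReal_mul hnn,
    ENNReal.ofReal_sum_of_nonneg (f := fun l => ‖u lam l‖ ^ 2) fun l _ => by positivity,
    Finset.mul_sum]
  refine Finset.sum_congr rfl fun l _ => ?_
  rw [ENNReal.ofReal_pow (norm_nonneg _), ofReal_norm]

lemma integrable_sum_norm_entries (hw : ∀ p q, Integrable (fun lam => w lam p q) freq) :
    Integrable (fun lam => ∑ i, ∑ j, ‖w lam i j‖) freq :=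
  integrable_finsetSum _ fun i _ => integrable_finsetSum _ fun j _ => (hw i j).norm

/-- Bounded functions are dense in the weighted space: cut off where the function is large. -/
lemma tendsto_weightedNormSq_sub_indicator
    (hw : ∀ p q, AEMeasurable (fun lam => w lam p q) freq)
    {u : ℝ → Fin T → ℂ} (hu : Measurable u) (hfin : weightedNormSq w u ≠ ∞) :
    Tendsto (fun M : ℕ => weightedNormSq w
      (u - {lam | ‖u lam‖ ≤ M}.indicator u)) atTop (𝓝 0) := by
  simp only [weightedNormSq_eq_lintegral_sesq]
  have hset : ∀ M : ℕ, MeasurableSet {lam | ‖u lam‖ ≤ M} := fun M =>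
    measurableSet_le hu.norm measurable_const
  have key : ∀ M : ℕ, ∀ lam, (u - {lam | ‖u lam‖ ≤ M}.indicator u) lam =
      if ‖u lam‖ ≤ M then 0 else u lam := by
    intro M lam
    by_cases h : ‖u lam‖ ≤ M <;> simp [h]
  have h0 : ∫⁻ _ : ℝ, (0 : ℝ≥0∞) ∂freq = 0 := by simp
  rw [← h0]
  refine tendsto_lintegral_of_dominated_convergence'
    (fun lam => ENNReal.ofReal (sesq (w lam) (u lam) (u lam)).re) (fun M => ?_) (fun M => ?_)
    hfin ?_
  · have hm := hu.sub (hu.indicator (hset M))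
    exact (Complex.measurable_re.comp_aemeasurable
      (aemeasurable_sesq hw hm.aemeasurable hm.aemeasurable)).ennreal_ofReal
  · refine Eventually.of_forall fun lam => ?_
    simp only [key]
    split_ifs
    · simp [sesq]
    · exact le_rfl
  · refine Eventually.of_forall fun lam => tendsto_const_nhds.congr' ?_
    obtain ⟨M₀, hM₀⟩ := exists_nat_ge ‖u lam‖
    filter_upwards [eventually_ge_atTop M₀] with M hM
    rw [key, if_pos (hM₀.trans (by exact_mod_cast hM))]
    simp [sesq]

lemma trig_mapDomain (c : ℤ →₀ ℂ) (l : Fin T) (lam : ℝ) :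
    trig (c.mapDomain fun k => (k, l)) lam = Pi.single l (c.sum fun k z => z * expo k lam) := by
  rw [trig_apply, Finsupp.sum_mapDomain_index (by simp)
    (by intro _ _ _; simp [add_mul, Pi.single_add])]
  ext p
  simp only [Finsupp.sum, Finset.sum_apply, Pi.single_apply]
  split_ifs <;> simp

lemma two_mul_add_two_mul_lt {a b ε : ℝ≥0∞} (ha : a < ε / 4) (hb : b < ε / 4) :
    2 * a + 2 * b < ε := by
  have h : 2 * (ε / 4) + 2 * (ε / 4) = ε := by
    rw [← add_mul, show (2 : ℝ≥0∞) + 2 = 4 by norm_num,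
      ENNReal.mul_div_cancel (by norm_num) (by norm_num)]
  calc 2 * a + 2 * b < 2 * (ε / 4) + 2 * (ε / 4) := by
        refine ENNReal.add_lt_add ?_ ?_
        · exact (ENNReal.mul_lt_mul_iff_right (by norm_num) (by norm_num)).2 ha
        · exact (ENNReal.mul_lt_mul_iff_right (by norm_num) (by norm_num)).2 hb
    _ = ε := h

/-- Trigonometric polynomials are dense in the weighted space of an integrable matrix density. -/
lemma exists_trig_approx (hw : ∀ p q, Integrable (fun lam => w lam p q) freq)
    (hpos : ∀ᵐ lam ∂freq, (w lam).PosSemidef) {u : ℝ → Fin T → ℂ} (hu : AEMeasurable u freq)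
    (hfin : weightedNormSq w u ≠ ∞) {ε : ℝ≥0∞} (hε : 0 < ε) :
    ∃ c : (ℤ × Fin T) →₀ ℂ, weightedNormSq w (u - trig c) < ε := by
  have hwm : ∀ p q, AEMeasurable (fun lam => w lam p q) freq := fun p q => (hw p q).1.aemeasurable
  have hmk := hu.ae_eq_mk
  have hfin' : weightedNormSq w (hu.mk u) ≠ ∞ := by rwa [← weightedNormSq_congr hmk]
  have hε4 : 0 < ε / 4 := ENNReal.div_pos hε.ne' (by norm_num)
  obtain ⟨M, hM⟩ := ((tendsto_weightedNormSq_sub_indicator hwm hu.measurable_mk hfin').eventually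
    (gt_mem_nhds hε4)).exists
  set v : ℝ → Fin T → ℂ := {lam | ‖hu.mk u lam‖ ≤ M}.indicator (hu.mk u) with hv
  have hvm : Measurable v := hu.measurable_mk.indicator
    (measurableSet_le hu.measurable_mk.norm measurable_const)
  have hvb : ∀ l lam, ‖v lam l‖ ≤ M := by
    intro l lam
    refine (norm_le_pi_norm _ l).trans ?_
    by_cases h : ‖hu.mk u lam‖ ≤ M <;> simp [hv, h]
  obtain ⟨ε', hε'0, hε'⟩ := ENNReal.exists_pos_sum_of_countable' hε4.ne' (Fin T)
  have hc : ∀ l, ∃ c : ℤ →₀ ℂ, ∫⁻ lam, ENNReal.ofReal (∑ i, ∑ j, ‖w lam i j‖) *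
      ‖v lam l - c.sum fun k z => z * expo k lam‖ₑ ^ 2 ∂freq < ε' l := fun l =>
    exists_trig_approx_scalar (integrable_sum_norm_entries hw)
      ((measurable_pi_apply l).comp hvm) (hvb l) (hε'0 l)
  choose c hc using hc
  refine ⟨∑ l, (c l).mapDomain fun k => (k, l), ?_⟩
  set b := ∑ l, (c l).mapDomain fun k => (k, l) with hb
  have hbl : ∀ lam l, trig b lam l = (c l).sum fun k z => z * expo k lam := by
    intro lam l
    rw [hb, map_sum, Finset.sum_apply, Finset.sum_apply]
    simp only [trig_mapDomain, Pi.single_apply]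
    simp
  have hbm : Measurable (trig b) := (continuous_trig b).measurable
  have h2 : weightedNormSq w (trig b - v) < ε / 4 := by
    refine (weightedNormSq_le_sum _ hwm (hbm.sub hvm).aemeasurable).trans_lt (lt_of_le_of_lt ?_ hε')
    rw [tsum_fintype]
    refine Finset.sum_le_sum fun l _ => (le_of_eq ?_).trans (hc l).le
    simp only [Pi.sub_apply, hbl, enorm_sub_rev]
  have h3 : weightedNormSq w (u - trig b) = weightedNormSq w ((hu.mk u - v) - (trig b - v)) := by
    rw [sub_sub_sub_cancel_right]
    exact weightedNormSq_congr (hmk.sub (ae_eq_refl _))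
  rw [h3]
  exact (weightedNormSq_sub_le hwm hpos (hu.measurable_mk.sub hvm).aemeasurable).trans_lt
    (two_mul_add_two_mul_lt hM h2)

lemma exists_seq_trig_tendsto (hw : ∀ p q, Integrable (fun lam => w lam p q) freq)
    (hpos : ∀ᵐ lam ∂freq, (w lam).PosSemidef) {u : ℝ → Fin T → ℂ} (hu : AEMeasurable u freq)
    (hfin : weightedNormSq w u ≠ ∞) :
    ∃ c : ℕ → (ℤ × Fin T) →₀ ℂ,
      Tendsto (fun n => weightedNormSq w (u - trig (c n))) atTop (𝓝 0) := by
  choose c hc using fun n : ℕ => exists_trig_approx hw hpos hu hfin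
    (ε := ((n : ℝ≥0∞) + 1)⁻¹) (by simp)
  refine ⟨c, tendsto_of_tendsto_of_tendsto_of_le_of_le tendsto_const_nhds ?_
    (fun n => zero_le) fun n => (hc n).le⟩
  have := (ENNReal.tendsto_inv_nat_nhds_zero).comp (tendsto_add_atTop_nat 1)
  refine this.congr fun n => ?_
  simp

/-! ### Bounded functionals on the weighted space -/

/-- Integrated Cauchy–Schwarz inequality for the entries of `uᵀ w`. -/
lemma lintegral_enorm_vecMul_le (hpos : ∀ᵐ lam ∂freq, (w lam).PosSemidef)
    (hw : ∀ p q, AEMeasurable (fun lam => w lam p q) freq)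
    {u : ℝ → Fin T → ℂ} (hu : AEMeasurable u freq) (l : Fin T) {δ : ℝ} (hδ : 0 < δ) :
    ∫⁻ lam, ‖(u lam ᵥ* w lam) l‖ₑ ∂freq ≤ ENNReal.ofReal δ⁻¹ * weightedNormSq w u +
      ENNReal.ofReal δ * ∫⁻ lam, ENNReal.ofReal (w lam l l).re ∂freq := by
  have hm : AEMeasurable (fun lam => ENNReal.ofReal (sesq (w lam) (u lam) (u lam)).re) freq :=
    (Complex.measurable_re.comp_aemeasurable (aemeasurable_sesq hw hu hu)).ennreal_ofReal
  rw [weightedNormSq_eq_lintegral_sesq, ← lintegral_const_mul' _ _ (by simp),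
    ← lintegral_const_mul' _ _ (by simp), ← lintegral_add_left' (hm.const_mul _)]
  refine lintegral_mono_ae ?_
  filter_upwards [hpos] with lam hlam
  have h := norm_vecMul_apply_le hlam (u lam) l hδ
  have h1 := sesq_self_nonneg hlam (u lam)
  have h2 := (Complex.le_def.1 (hlam.diag_nonneg (i := l))).1
  simp only [Complex.zero_re] at h2
  have hδ' : 0 ≤ δ⁻¹ := by positivity
  rw [← ENNReal.ofReal_mul hδ', ← ENNReal.ofReal_mul hδ.le,
    ← ENNReal.ofReal_add (by positivity) (by positivity), ← ofReal_norm]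
  exact ENNReal.ofReal_le_ofReal h

/-- Integrated Cauchy–Schwarz inequality for the entries of `u` itself, against `w⁻¹`. -/
lemma lintegral_enorm_apply_le (hpos : ∀ᵐ lam ∂freq, (w lam).PosDef)
    (hw : ∀ p q, AEMeasurable (fun lam => w lam p q) freq)
    {u : ℝ → Fin T → ℂ} (hu : AEMeasurable u freq) (l : Fin T) {δ : ℝ} (hδ : 0 < δ) :
    ∫⁻ lam, ‖u lam l‖ₑ ∂freq ≤ ENNReal.ofReal δ⁻¹ * weightedNormSq w u +
      ENNReal.ofReal δ * ∫⁻ lam, ENNReal.ofReal ((w lam)⁻¹.trace).re ∂freq := by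
  have hm : AEMeasurable (fun lam => ENNReal.ofReal (sesq (w lam) (u lam) (u lam)).re) freq :=
    (Complex.measurable_re.comp_aemeasurable (aemeasurable_sesq hw hu hu)).ennreal_ofReal
  rw [weightedNormSq_eq_lintegral_sesq, ← lintegral_const_mul' _ _ (by simp),
    ← lintegral_const_mul' _ _ (by simp), ← lintegral_add_left' (hm.const_mul _)]
  refine lintegral_mono_ae ?_
  filter_upwards [hpos] with lam hlam
  have h := norm_apply_le hlam (u lam) l hδ
  have h1 := sesq_self_nonneg hlam.posSemidef (u lam)
  have h2 : 0 ≤ ((w lam)⁻¹.trace).re := (Complex.le_def.1 hlam.inv.posSemidef.trace_nonneg).1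
  have hδ' : 0 ≤ δ⁻¹ := by positivity
  rw [← ENNReal.ofReal_mul hδ', ← ENNReal.ofReal_mul hδ.le,
    ← ENNReal.ofReal_add (by positivity) (by positivity), ← ofReal_norm]
  exact ENNReal.ofReal_le_ofReal h

/-- Continuity from the additive Cauchy–Schwarz inequality: `δ` is chosen first, to make the
second term small, and `n` afterwards. -/
lemma tendsto_zero_of_le_add {a b : ℕ → ℝ≥0∞} {K : ℝ≥0∞} (hK : K ≠ ∞)
    (hab : ∀ δ : ℝ, 0 < δ → ∀ n, a n ≤ ENNReal.ofReal δ⁻¹ * b n + ENNReal.ofReal δ * K)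
    (hb : Tendsto b atTop (𝓝 0)) : Tendsto a atTop (𝓝 0) := by
  rw [ENNReal.tendsto_nhds_zero]
  intro ε hε
  have hlim : Tendsto (fun δ : ℝ => ENNReal.ofReal δ * K) (𝓝[>] 0) (𝓝 0) := by
    have : Tendsto (fun δ : ℝ => ENNReal.ofReal δ * K) (𝓝 0) (𝓝 (ENNReal.ofReal 0 * K)) :=
      ENNReal.Tendsto.mul_const (ENNReal.tendsto_ofReal tendsto_id) (Or.inr hK)
    rw [ENNReal.ofReal_zero, zero_mul] at this
    exact this.mono_left nhdsWithin_le_nhds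
  have hε2 : 0 < ε / 2 := ENNReal.div_pos hε.ne' (by norm_num)
  obtain ⟨δ, hδK, hδ⟩ := ((hlim.eventually (gt_mem_nhds hε2)).and self_mem_nhdsWithin).exists
  have hδ' : (0 : ℝ) < δ := hδ
  have hlim2 : Tendsto (fun n => ENNReal.ofReal δ⁻¹ * b n) atTop (𝓝 0) := by
    simpa using ENNReal.Tendsto.const_mul hb (Or.inr ENNReal.ofReal_ne_top)
  filter_upwards [hlim2.eventually (gt_mem_nhds hε2)] with n hn
  calc a n ≤ _ := hab δ hδ' n
    _ ≤ ε / 2 + ε / 2 := add_le_add hn.le hδK.le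
    _ = ε := ENNReal.add_halves ε

lemma lintegral_ofReal_re_ne_top {φ : ℝ → ℂ} (h : Integrable φ freq) :
    ∫⁻ lam, ENNReal.ofReal (φ lam).re ∂freq ≠ ∞ := by
  refine ((lintegral_mono fun lam => ?_).trans_lt h.2).ne
  rw [← ofReal_norm]
  exact ENNReal.ofReal_le_ofReal (Complex.re_le_norm _)

lemma integrable_expo_mul {φ : ℝ → ℂ} (h : Integrable φ freq) (k : ℤ) :
    Integrable (fun lam => expo k lam * φ lam) freq :=
  h.bdd_mul (c := 1) (continuous_expo k).aestronglyMeasurable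
    (Eventually.of_forall fun lam => (norm_expo k lam).le)

lemma integrable_vecMul (hpos : ∀ᵐ lam ∂freq, (w lam).PosSemidef)
    (hw : ∀ p q, Integrable (fun lam => w lam p q) freq)
    {u : ℝ → Fin T → ℂ} (hu : AEMeasurable u freq) (hfin : weightedNormSq w u ≠ ∞) (l : Fin T) :
    Integrable (fun lam => (u lam ᵥ* w lam) l) freq := by
  have hwm : ∀ p q, AEMeasurable (fun lam => w lam p q) freq := fun p q => (hw p q).1.aemeasurable
  refine ⟨(aemeasurable_pi_iff.1 (aemeasurable_vecMul hwm hu) l).aestronglyMeasurable, ?_⟩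
  refine (lintegral_enorm_vecMul_le hpos hwm hu l one_pos).trans_lt ?_
  simpa using ⟨hfin.lt_top, (lintegral_ofReal_re_ne_top (hw l l)).lt_top⟩

lemma integrable_apply (hpos : ∀ᵐ lam ∂freq, (w lam).PosDef)
    (hw : ∀ p q, Integrable (fun lam => w lam p q) freq)
    (hinv : Integrable (fun lam => (w lam)⁻¹.trace) freq)
    {u : ℝ → Fin T → ℂ} (hu : AEMeasurable u freq) (hfin : weightedNormSq w u ≠ ∞) (l : Fin T) :
    Integrable (fun lam => u lam l) freq := by
  have hwm : ∀ p q, AEMeasurable (fun lam => w lam p q) freq := fun p q => (hw p q).1.aemeasurable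
  refine ⟨(aemeasurable_pi_iff.1 hu l).aestronglyMeasurable, ?_⟩
  refine (lintegral_enorm_apply_le hpos hwm hu l one_pos).trans_lt ?_
  simpa using ⟨hfin.lt_top, (lintegral_ofReal_re_ne_top hinv).lt_top⟩

lemma weightedNormSq_le_of_bound {u : ℝ → Fin T → ℂ} {C : ℝ} (hC : ∀ lam l, ‖u lam l‖ ≤ C) :
    weightedNormSq w u ≤ ENNReal.ofReal (T * C ^ 2) *
      ∫⁻ lam, ENNReal.ofReal (∑ i, ∑ j, ‖w lam i j‖) ∂freq := by
  rw [← lintegral_const_mul' _ _ ENNReal.ofReal_ne_top, weightedNormSq_eq_lintegral_sesq]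
  refine lintegral_mono fun lam => ?_
  rw [← ENNReal.ofReal_mul (by positivity), mul_comm]
  refine ENNReal.ofReal_le_ofReal ((re_sesq_self_le (u lam)).trans ?_)
  have hsum : ∑ l, ‖u lam l‖ ^ 2 ≤ T * C ^ 2 := by
    calc ∑ l, ‖u lam l‖ ^ 2 ≤ ∑ _l : Fin T, C ^ 2 :=
          Finset.sum_le_sum fun l _ => pow_le_pow_left₀ (norm_nonneg _) (hC lam l) 2
      _ = T * C ^ 2 := by simp
  exact mul_le_mul_of_nonneg_left hsum
    (Finset.sum_nonneg fun i _ => Finset.sum_nonneg fun j _ => norm_nonneg _)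

lemma weightedNormSq_trig_le (w : ℝ → Matrix (Fin T) (Fin T) ℂ)
    (c : (ℤ × Fin T) →₀ ℂ) {s : Finset (ℤ × Fin T)} (hs : c.support ⊆ s) :
    weightedNormSq w (trig c) ≤ ENNReal.ofReal (T * (∑ x ∈ s, ‖c x‖) ^ 2) *
      ∫⁻ lam, ENNReal.ofReal (∑ i, ∑ j, ‖w lam i j‖) ∂freq :=
  weightedNormSq_le_of_bound fun lam l => (norm_trig_apply_le c lam l).trans
    (Finset.sum_le_sum_of_subset_of_nonneg hs fun _ _ _ => norm_nonneg _)

lemma lintegral_sum_norm_entries_ne_top (hw : ∀ p q, Integrable (fun lam => w lam p q) freq) :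
    ∫⁻ lam, ENNReal.ofReal (∑ i, ∑ j, ‖w lam i j‖) ∂freq ≠ ∞ :=
  (integrable_sum_norm_entries hw).lintegral_lt_top.ne

lemma weightedNormSq_trig_ne_top (hw : ∀ p q, Integrable (fun lam => w lam p q) freq)
    (c : (ℤ × Fin T) →₀ ℂ) : weightedNormSq w (trig c) ≠ ∞ :=
  ((weightedNormSq_trig_le w c subset_rfl).trans_lt (ENNReal.mul_lt_top ENNReal.ofReal_lt_top
    (lintegral_sum_norm_entries_ne_top hw).lt_top)).ne

/-- The role of minimality: a function in the weighted space whose Fourier coefficients vanish on a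
finite set `J` is a limit of trigonometric polynomials with frequencies outside `J`. Minimality
makes Fourier coefficients continuous, so that in any approximation the coefficients on `J` tend to
zero and can be deleted. -/
lemma exists_seq_trig_off (hpos : ∀ᵐ lam ∂freq, (w lam).PosDef)
    (hw : ∀ p q, Integrable (fun lam => w lam p q) freq)
    (hinv : Integrable (fun lam => (w lam)⁻¹.trace) freq)
    {u : ℝ → Fin T → ℂ} (hu : AEMeasurable u freq) (hfin : weightedNormSq w u ≠ ∞)
    (J : Finset ℤ) (hJ : ∀ k ∈ J, ∀ l, ∫ lam, expo (-k) lam * u lam l ∂freq = 0) :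
    ∃ c : ℕ → (ℤ × Fin T) →₀ ℂ, (∀ n, ∀ x ∈ (c n).support, x.1 ∉ J) ∧
      Tendsto (fun n => weightedNormSq w (u - trig (c n))) atTop (𝓝 0) := by
  have hwm : ∀ p q, AEMeasurable (fun lam => w lam p q) freq := fun p q => (hw p q).1.aemeasurable
  have hpsd : ∀ᵐ lam ∂freq, (w lam).PosSemidef := hpos.mono fun _ h => h.posSemidef
  obtain ⟨c, hc⟩ := exists_seq_trig_tendsto hw hpsd hu hfin
  have hdm : ∀ n, AEMeasurable (u - trig (c n)) freq := fun n =>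
    hu.sub (continuous_trig _).aemeasurable
  have hL1 : ∀ l, Tendsto (fun n => ∫⁻ lam, ‖(u - trig (c n)) lam l‖ₑ ∂freq) atTop (𝓝 0) :=
    fun l => tendsto_zero_of_le_add (lintegral_ofReal_re_ne_top hinv)
      (fun δ hδ n => lintegral_enorm_apply_le hpos hwm (hdm n) l hδ) hc
  have hcoef : ∀ k ∈ J, ∀ l, Tendsto (fun n => ‖c n (k, l)‖) atTop (𝓝 0) := by
    intro k hk l
    have hb : ∀ n, ‖2 * (Real.pi : ℂ) * c n (k, l)‖ₑ ≤
        ∫⁻ lam, ‖(u - trig (c n)) lam l‖ₑ ∂freq := by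
      intro n
      have hi1 := integrable_expo_mul (integrable_apply hpos hw hinv hu hfin l) (-k)
      have hi2 := integrable_expo_mul (integrable_apply hpos hw hinv
        (continuous_trig (c n)).aemeasurable (weightedNormSq_trig_ne_top hw (c n)) l) (-k)
      have : 2 * (Real.pi : ℂ) * c n (k, l) =
          -∫ lam, expo (-k) lam * (u - trig (c n)) lam l ∂freq := by
        simp only [Pi.sub_apply, mul_sub]
        rw [integral_sub hi1 hi2, hJ k hk, integral_expo_mul_trig]
        ring
      rw [this, enorm_neg]
      refine (enorm_integral_le_lintegral_enorm _).trans (lintegral_mono fun lam => ?_)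
      rw [enorm_mul, ← ofReal_norm (expo _ _), norm_expo]
      simp
    have h0 : Tendsto (fun n => ‖2 * (Real.pi : ℂ) * c n (k, l)‖ₑ) atTop (𝓝 0) :=
      tendsto_of_tendsto_of_tendsto_of_le_of_le tendsto_const_nhds (hL1 l)
        (fun n => zero_le) hb
    have h1 := (ENNReal.tendsto_toReal ENNReal.zero_ne_top).comp h0
    simp only [Function.comp_def, toReal_enorm, ENNReal.toReal_zero, norm_mul] at h1
    have h2 := h1.const_mul (‖(2 : ℂ)‖ * ‖(Real.pi : ℂ)‖)⁻¹
    rw [mul_zero] at h2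
    refine h2.congr fun n => ?_
    have : ‖(2 : ℂ)‖ * ‖(Real.pi : ℂ)‖ ≠ 0 := by simp [Real.pi_ne_zero]
    rw [inv_mul_cancel_left₀ this]
  set s : Finset (ℤ × Fin T) := J ×ˢ Finset.univ with hs
  have hin : ∀ n, ((c n).filter fun x => x.1 ∈ J).support ⊆ s := by
    intro n x hx
    simp only [Finsupp.support_filter, Finset.mem_filter] at hx
    simp [hs, hx.2]
  have hsmall : Tendsto (fun n => weightedNormSq w (trig ((c n).filter fun x => x.1 ∈ J))) atTop
      (𝓝 0) := by
    have hS : Tendsto (fun n => ∑ x ∈ s, ‖((c n).filter fun x => x.1 ∈ J) x‖) atTop (𝓝 0) := by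
      rw [← Finset.sum_const_zero (s := s)]
      refine tendsto_finsetSum _ fun x hx => ?_
      have hxJ : x.1 ∈ J := by simpa [hs] using hx
      refine (hcoef x.1 hxJ x.2).congr fun n => ?_
      rw [Finsupp.filter_apply_pos (fun x : ℤ × Fin T => x.1 ∈ J) _ hxJ]
    have hS2 := ENNReal.tendsto_ofReal ((hS.pow 2).const_mul (T : ℝ))
    have hS3 := ENNReal.Tendsto.mul_const hS2 (Or.inr (lintegral_sum_norm_entries_ne_top hw))
    simp only [ne_eq, OfNat.ofNat_ne_zero, not_false_eq_true, zero_pow, mul_zero,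
      ENNReal.ofReal_zero, zero_mul] at hS3
    exact tendsto_of_tendsto_of_tendsto_of_le_of_le tendsto_const_nhds hS3 (fun n => zero_le)
      fun n => weightedNormSq_trig_le w _ (hin n)
  refine ⟨fun n => (c n).filter fun x => x.1 ∉ J, fun n x hx => ?_, ?_⟩
  · simp only [Finsupp.support_filter, Finset.mem_filter] at hx
    exact hx.2
  · have hlim : Tendsto (fun n => 2 * weightedNormSq w (u - trig (c n)) +
        2 * weightedNormSq w (-trig ((c n).filter fun x => x.1 ∈ J))) atTop (𝓝 0) := by
      have hneg : ∀ v : ℝ → Fin T → ℂ, weightedNormSq w (-v) = weightedNormSq w v := by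
        intro v; simp [weightedNormSq, Matrix.mulVec_neg]
      simp only [hneg]
      simpa using (ENNReal.Tendsto.const_mul hc (Or.inr (by norm_num : (2 : ℝ≥0∞) ≠ ∞))).add
        (ENNReal.Tendsto.const_mul hsmall (Or.inr (by norm_num : (2 : ℝ≥0∞) ≠ ∞)))
    refine tendsto_of_tendsto_of_tendsto_of_le_of_le tendsto_const_nhds hlim (fun n => zero_le)
      fun n => ?_
    have hsplit : u - trig ((c n).filter fun x => x.1 ∉ J) =
        (u - trig (c n)) - -trig ((c n).filter fun x => x.1 ∈ J) := by
      have h := Finsupp.filter_add_filter_not (c n) fun x => x.1 ∈ J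
      conv_rhs => rw [← h]
      rw [map_add]
      simp only [sub_neg_eq_add]
      rw [h]
      abel
    simp only
    rw [hsplit]
    exact weightedNormSq_sub_le hwm hpsd (hdm n)

end Weighted

/-! ### The spectral isometry -/

section Isometry

variable {Ω : Type*} [MeasurableSpace Ω] {P : Measure Ω} {T : ℕ} {Y : ℤ → Fin T → Ω → ℂ}
  {w : ℝ → Matrix (Fin T) (Fin T) ℂ}

/-- The linear combination `∑ c(k, l) Y_l(k)`, as an element of `L²(Ω)`. -/
noncomputable def combo (hY : ∀ k l, MemLp (Y k l) 2 P) : ((ℤ × Fin T) →₀ ℂ) →ₗ[ℂ] Lp ℂ 2 P :=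
  Finsupp.linearCombination ℂ fun x => (hY x.1 x.2).toLp (Y x.1 x.2)

lemma combo_single (hY : ∀ k l, MemLp (Y k l) 2 P) (x : ℤ × Fin T) (z : ℂ) :
    combo hY (Finsupp.single x z) = z • (hY x.1 x.2).toLp (Y x.1 x.2) :=
  Finsupp.linearCombination_single _ _ _

lemma coeFn_combo (hY : ∀ k l, MemLp (Y k l) 2 P) (c : (ℤ × Fin T) →₀ ℂ) :
    combo hY c =ᵐ[P] fun ω => c.sum fun x z => z * Y x.1 x.2 ω := by
  rw [combo, Finsupp.linearCombination_apply, Finsupp.sum]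
  refine (Lp.coeFn_finsetSum _ _).trans ?_
  have h : ∀ᵐ ω ∂P, ∀ x ∈ c.support,
      (c x • (hY x.1 x.2).toLp (Y x.1 x.2) : Lp ℂ 2 P) ω = c x * Y x.1 x.2 ω := by
    refine (ae_ball_iff c.support.countable_toSet).2 fun x _ => ?_
    filter_upwards [Lp.coeFn_smul (c x) ((hY x.1 x.2).toLp (Y x.1 x.2)),
      (hY x.1 x.2).coeFn_toLp] with ω h1 h2
    rw [h1, Pi.smul_apply, h2, smul_eq_mul]
  filter_upwards [h] with ω hω
  rw [Finset.sum_apply, Finsupp.sum]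
  exact Finset.sum_congr rfl fun x hx => hω x hx

lemma inner_toLp {X X' : Ω → ℂ} (hX : MemLp X 2 P) (hX' : MemLp X' 2 P) :
    inner ℂ (hX.toLp X) (hX'.toLp X') = ∫ ω, X' ω * conj (X ω) ∂P := by
  rw [L2.inner_def]
  refine integral_congr_ae ?_
  filter_upwards [hX.coeFn_toLp, hX'.coeFn_toLp] with ω h1 h2
  rw [h1, h2, RCLike.inner_apply]

/-- Covariances with `Y_l(k)` in spectral terms. -/
lemma inner_toLp_combo (h : HasSpectralDensity P Y w) (k : ℤ) (l : Fin T)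
    (c : (ℤ × Fin T) →₀ ℂ) :
    inner ℂ ((h.memLp k l).toLp (Y k l)) (combo h.memLp c) =
      ∫ lam, expo (-k) lam * (trig c lam ᵥ* w lam) l ∂freq := by
  induction c using Finsupp.induction_linear with
  | zero => simp
  | add c c' hc hc' =>
    have hi : ∀ b : (ℤ × Fin T) →₀ ℂ,
        Integrable (fun lam => expo (-k) lam * (trig b lam ᵥ* w lam) l) freq := fun b =>
      integrable_expo_mul (integrable_vecMul h.posSemidef h.integrable
        (continuous_trig b).aemeasurable (weightedNormSq_trig_ne_top h.integrable b) l) _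
    simp only [map_add, inner_add_right, hc, hc', Pi.add_apply, Matrix.add_vecMul, mul_add]
    rw [integral_add (hi c) (hi c')]
  | single x z =>
    obtain ⟨j, q⟩ := x
    rw [combo_single, inner_smul_right, inner_toLp]
    have hcov := h.covariance (j - k) k q l
    rw [add_sub_cancel] at hcov
    rw [hcov, ← integral_const_mul]
    refine integral_congr_ae (Eventually.of_forall fun lam => ?_)
    simp only [trig_single, Matrix.single_vecMul, Pi.smul_apply, Matrix.row]
    rw [sub_eq_add_neg, expo_add, smul_eq_mul]
    ring

lemma integrable_sesq_self (h : HasSpectralDensity P Y w) {u : ℝ → Fin T → ℂ}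
    (hu : AEMeasurable u freq) (hfin : weightedNormSq w u ≠ ∞) :
    Integrable (fun lam => (sesq (w lam) (u lam) (u lam)).re) freq := by
  have hwm : ∀ p q, AEMeasurable (fun lam => w lam p q) freq :=
    fun p q => (h.integrable p q).1.aemeasurable
  refine ⟨(Complex.measurable_re.comp_aemeasurable
    (aemeasurable_sesq hwm hu hu)).aestronglyMeasurable, ?_⟩
  rw [hasFiniteIntegral_iff_ofReal (h.posSemidef.mono fun lam hlam => sesq_self_nonneg hlam _)]
  exact hfin.lt_top

/-- The isometry between the weighted space and the span of the sequence. -/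
lemma inner_combo_self (h : HasSpectralDensity P Y w) (c c' : (ℤ × Fin T) →₀ ℂ) :
    inner ℂ (combo h.memLp c') (combo h.memLp c) =
      ∫ lam, sesq (w lam) (trig c lam) (trig c' lam) ∂freq := by
  induction c' using Finsupp.induction_linear with
  | zero => simp [sesq]
  | add b b' hb hb' =>
    have hwm : ∀ p q, AEMeasurable (fun lam => w lam p q) freq :=
      fun p q => (h.integrable p q).1.aemeasurable
    have hm : ∀ a : (ℤ × Fin T) →₀ ℂ, AEMeasurable (trig a) freq :=
      fun a => (continuous_trig a).aemeasurable
    have hi : ∀ a : (ℤ × Fin T) →₀ ℂ,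
        Integrable (fun lam => sesq (w lam) (trig c lam) (trig a lam)) freq := by
      intro a
      refine Integrable.mono' ((integrable_sesq_self h (hm c)
        (weightedNormSq_trig_ne_top h.integrable c)).add (integrable_sesq_self h (hm a)
        (weightedNormSq_trig_ne_top h.integrable a)))
        (aemeasurable_sesq hwm (hm c) (hm a)).aestronglyMeasurable ?_
      filter_upwards [h.posSemidef] with lam hlam
      simpa using norm_sesq_le hlam (trig c lam) (trig a lam) one_pos
    simp only [map_add, inner_add_left, hb, hb', Pi.add_apply, sesq_add_right]
    rw [integral_add (hi b) (hi b')]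
  | single x z =>
    obtain ⟨k, l⟩ := x
    rw [combo_single, inner_smul_left, inner_toLp_combo h, ← integral_const_mul]
    refine integral_congr_ae (Eventually.of_forall fun lam => ?_)
    have : Pi.single l (z * expo k lam) = (z * expo k lam) • (Pi.single l 1 : Fin T → ℂ) := by
      rw [← Pi.single_smul, smul_eq_mul, mul_one]
    simp only [trig_single, this, sesq_smul_right, sesq_single_right, map_mul, conj_expo]
    ring

lemma enorm_combo_sq (h : HasSpectralDensity P Y w) (c : (ℤ × Fin T) →₀ ℂ) :
    ‖combo h.memLp c‖ₑ ^ 2 = weightedNormSq w (trig c) := by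
  have h1 := inner_combo_self h c c
  have hm : AEMeasurable (trig c) freq := (continuous_trig c).aemeasurable
  have hi := integrable_sesq_self h hm (weightedNormSq_trig_ne_top h.integrable c)
  have h2 : ‖combo h.memLp c‖ ^ 2 = ∫ lam, (sesq (w lam) (trig c lam) (trig c lam)).re ∂freq := by
    have h3 : ∫ lam, sesq (w lam) (trig c lam) (trig c lam) ∂freq =
        ((∫ lam, (sesq (w lam) (trig c lam) (trig c lam)).re ∂freq : ℝ) : ℂ) := by
      rw [← integral_complex_ofReal]
      refine integral_congr_ae (h.posSemidef.mono fun lam hlam => ?_)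
      exact Complex.ext (by simp) (by simpa using sesq_self_im hlam.1 (trig c lam))
    rw [h3, inner_self_eq_norm_sq_to_K] at h1
    exact Complex.ofReal_injective (by rw [Complex.ofReal_pow]; exact h1)
  rw [weightedNormSq_eq_lintegral_sesq, ← ofReal_integral_eq_lintegral_ofReal hi
    (h.posSemidef.mono fun lam hlam => sesq_self_nonneg hlam _), ← h2,
    ENNReal.ofReal_pow (norm_nonneg _), ofReal_norm]

/-- `Z = ∫ uᵀ dZ_Y` for the stochastic spectral measure `Z_Y` of the sequence `Y`. -/
def IsSpectralImage (hY : ∀ k l, MemLp (Y k l) 2 P) (w : ℝ → Matrix (Fin T) (Fin T) ℂ)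
    (Z : Lp ℂ 2 P) (u : ℝ → Fin T → ℂ) : Prop :=
  AEMeasurable u freq ∧ ∀ ε : ℝ≥0∞, 0 < ε → ∃ c : (ℤ × Fin T) →₀ ℂ,
    weightedNormSq w (u - trig c) < ε ∧ ‖Z - combo hY c‖ₑ < ε

/-- A spectral characteristic is determined by its image, up to null sets. -/
lemma IsSpectralImage.ae_eq (h : HasSpectralDensity P Y w) (hpos : ∀ᵐ lam ∂freq, (w lam).PosDef)
    {Z : Lp ℂ 2 P} {u v : ℝ → Fin T → ℂ} (hu : IsSpectralImage h.memLp w Z u)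
    (hv : IsSpectralImage h.memLp w Z v) : u =ᵐ[freq] v := by
  have hwm : ∀ p q, AEMeasurable (fun lam => w lam p q) freq :=
    fun p q => (h.integrable p q).1.aemeasurable
  refine ae_eq_of_weightedNormSq_sub_eq_zero hwm hpos hu.1 hv.1 ?_
  refine le_antisymm (ENNReal.le_of_forall_pos_le_add fun ε hε _ => ?_) zero_le
  rw [zero_add]
  set η : ℝ≥0∞ := min ((ε : ℝ≥0∞) / 4 / 4) 1 with hη
  have hε0 : (0 : ℝ≥0∞) < ε := by exact_mod_cast hε
  have hη0 : 0 < η :=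
    lt_min (ENNReal.div_pos (ENNReal.div_pos hε0.ne' (by norm_num)).ne' (by norm_num)) one_pos
  have hη4 : η ≤ (ε : ℝ≥0∞) / 4 / 4 := min_le_left _ _
  have h44 : (ε : ℝ≥0∞) / 4 / 4 ≤ (ε : ℝ≥0∞) / 4 := by
    conv_rhs => rw [← div_one ((ε : ℝ≥0∞) / 4)]
    exact ENNReal.div_le_div_left (by norm_num) _
  obtain ⟨c, hc, hcZ⟩ := hu.2 (η / 2) (ENNReal.div_pos hη0.ne' (by norm_num))
  obtain ⟨b, hb, hbZ⟩ := hv.2 (η / 2) (ENNReal.div_pos hη0.ne' (by norm_num))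
  have hhalf : η / 2 ≤ η := ENNReal.half_le_self
  have hdist : ‖combo h.memLp (b - c)‖ₑ < η := by
    rw [map_sub, show combo h.memLp b - combo h.memLp c =
      (Z - combo h.memLp c) - (Z - combo h.memLp b) by abel]
    calc _ ≤ ‖Z - combo h.memLp c‖ₑ + ‖Z - combo h.memLp b‖ₑ := enorm_sub_le
      _ < η / 2 + η / 2 := ENNReal.add_lt_add hcZ hbZ
      _ = η := ENNReal.add_halves η
  have hbc : weightedNormSq w (trig (b - c)) < ε / 4 / 4 := by
    rw [← enorm_combo_sq h, sq]
    calc _ ≤ ‖combo h.memLp (b - c)‖ₑ * 1 := by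
          gcongr; exact hdist.le.trans (min_le_right _ _)
      _ < _ := by rw [mul_one]; exact hdist.trans_le hη4
  have hmc := hu.1.sub (continuous_trig c).aemeasurable
  have hstep : weightedNormSq w ((u - trig c) - trig (b - c)) < ε / 4 :=
    (weightedNormSq_sub_le hwm h.posSemidef hmc).trans_lt
      (two_mul_add_two_mul_lt (hc.trans_le (hhalf.trans hη4)) hbc)
  -- Nearby images have nearby approximating combinations, by the isometry.
  have hsplit : u - v = ((u - trig c) - trig (b - c)) - (v - trig b) := by
    rw [map_sub]; abel
  rw [hsplit]
  exact ((weightedNormSq_sub_le hwm h.posSemidef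
    (hmc.sub (continuous_trig _).aemeasurable)).trans_lt
    (two_mul_add_two_mul_lt hstep (hb.trans_le (hhalf.trans (hη4.trans h44))))).le

/-- The closed span of the values of `Y` at the times outside `J`. -/
noncomputable def spanOff (P : Measure Ω) (Y : ℤ → Fin T → Ω → ℂ) (J : Finset ℤ) :
    Submodule ℂ (Lp ℂ 2 P) :=
  (Submodule.span ℂ {y : Lp ℂ 2 P | ∃ (k : ℤ) (l : Fin T),
    k ∉ J ∧ ⇑y =ᵐ[P] Y k l}).topologicalClosure

lemma toLp_mem_spanOff (hY : ∀ k l, MemLp (Y k l) 2 P) {J : Finset ℤ} {k : ℤ} (hk : k ∉ J)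
    (l : Fin T) : (hY k l).toLp (Y k l) ∈ spanOff P Y J :=
  Submodule.le_topologicalClosure _
    (Submodule.subset_span ⟨k, l, hk, (hY k l).coeFn_toLp⟩)

lemma combo_mem_spanOff (hY : ∀ k l, MemLp (Y k l) 2 P) {J : Finset ℤ} {c : (ℤ × Fin T) →₀ ℂ}
    (hc : ∀ x ∈ c.support, x.1 ∉ J) : combo hY c ∈ spanOff P Y J := by
  rw [combo, Finsupp.linearCombination_apply, Finsupp.sum]
  exact Submodule.sum_mem _ fun x hx =>
    Submodule.smul_mem _ _ (toLp_mem_spanOff hY (hc x hx) x.2)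

/-- Vectors orthogonal to all `Y_l(k)`, `k ∉ J`, are orthogonal to their closed span. -/
lemma inner_eq_zero_of_mem_spanOff (hY : ∀ k l, MemLp (Y k l) 2 P) {J : Finset ℤ} {V : Lp ℂ 2 P}
    (hV : ∀ k ∉ J, ∀ l, inner ℂ ((hY k l).toLp (Y k l)) V = 0) {Z : Lp ℂ 2 P}
    (hZ : Z ∈ spanOff P Y J) : inner ℂ Z V = 0 := by
  have hle : spanOff P Y J ≤ (Submodule.span ℂ {V})ᗮ := by
    refine Submodule.topologicalClosure_minimal _ (Submodule.span_le.2 ?_)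
      (Submodule.isClosed_orthogonal _)
    rintro y ⟨k, l, hk, hy⟩
    have : y = (hY k l).toLp (Y k l) := Lp.ext (hy.trans (hY k l).coeFn_toLp.symm)
    rw [SetLike.mem_coe, Submodule.mem_orthogonal_singleton_iff_inner_left, this]
    exact hV k hk l
  exact (Submodule.mem_orthogonal_singleton_iff_inner_left).1 (hle hZ)

/-- A weighted square integrable function whose Fourier coefficients vanish on `J` represents an
element of the closed span of the sequence off `J`. -/
lemma exists_spectralImage_mem_spanOff (h : HasSpectralDensity P Y w)
    (hpos : ∀ᵐ lam ∂freq, (w lam).PosDef)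
    (hinv : Integrable (fun lam => (w lam)⁻¹.trace) freq)
    {u : ℝ → Fin T → ℂ} (hu : AEMeasurable u freq) (hfin : weightedNormSq w u ≠ ∞)
    (J : Finset ℤ) (hJ : ∀ k ∈ J, ∀ l, ∫ lam, expo (-k) lam * u lam l ∂freq = 0) :
    ∃ Z ∈ spanOff P Y J, IsSpectralImage h.memLp w Z u ∧
      ∀ k l, inner ℂ ((h.memLp k l).toLp (Y k l)) Z =
        ∫ lam, expo (-k) lam * (u lam ᵥ* w lam) l ∂freq := by
  have hwm : ∀ p q, AEMeasurable (fun lam => w lam p q) freq :=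
    fun p q => (h.integrable p q).1.aemeasurable
  obtain ⟨c, hcJ, hc⟩ := exists_seq_trig_off hpos h.integrable hinv hu hfin J hJ
  have hdm : ∀ n, AEMeasurable (u - trig (c n)) freq := fun n =>
    hu.sub (continuous_trig _).aemeasurable
  have hcauchy : CauchySeq fun n => combo h.memLp (c n) := by
    rw [EMetric.cauchySeq_iff]
    intro ε hε
    set η := min ε 1 with hη
    have hη0 : 0 < η := lt_min hε one_pos
    have hη2 : 0 < η ^ 2 / 4 := ENNReal.div_pos (ENNReal.pow_pos hη0 2).ne' (by norm_num)
    obtain ⟨n₀, hn₀⟩ := eventually_atTop.1 (hc.eventually (gt_mem_nhds hη2))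
    refine ⟨n₀, fun m hm n hn => ?_⟩
    rw [edist_eq_enorm_sub, ← map_sub]
    have h1 : ‖combo h.memLp (c m - c n)‖ₑ ^ 2 < η ^ 2 := by
      rw [enorm_combo_sq h, show trig (c m - c n) = (u - trig (c n)) - (u - trig (c m)) by
        rw [map_sub]; abel]
      exact (weightedNormSq_sub_le hwm h.posSemidef (hdm n)).trans_lt
        (two_mul_add_two_mul_lt (hn₀ n hn) (hn₀ m hm))
    exact (lt_of_not_ge fun hle => h1.not_ge (pow_le_pow_left' hle 2)).trans_le (min_le_left _ _)
  obtain ⟨Z, hZ⟩ := cauchySeq_tendsto_of_complete hcauchy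
  refine ⟨Z, ?_, ⟨hu, fun ε hε => ?_⟩, fun k l => ?_⟩
  · exact (Submodule.isClosed_topologicalClosure _).mem_of_tendsto hZ
      (Eventually.of_forall fun n => combo_mem_spanOff h.memLp (hcJ n))
  · have h1 := hc.eventually (gt_mem_nhds hε)
    have h2 : ∀ᶠ n in atTop, ‖Z - combo h.memLp (c n)‖ₑ < ε := by
      have := (tendsto_iff_edist_tendsto_0.1 hZ).eventually (gt_mem_nhds hε)
      filter_upwards [this] with n hn
      rwa [edist_comm, edist_eq_enorm_sub] at hn
    obtain ⟨n, hn1, hn2⟩ := (h1.and h2).exists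
    exact ⟨c n, hn1, hn2⟩
  · have hlim1 : Tendsto (fun n => inner ℂ ((h.memLp k l).toLp (Y k l)) (combo h.memLp (c n)))
        atTop (𝓝 (inner ℂ ((h.memLp k l).toLp (Y k l)) Z)) := tendsto_const_nhds.inner hZ
    refine tendsto_nhds_unique hlim1 ?_
    simp only [inner_toLp_combo h]
    have hi := integrable_vecMul h.posSemidef h.integrable hu hfin l
    have hin : ∀ n, Integrable (fun lam => (trig (c n) lam ᵥ* w lam) l) freq := fun n =>
      integrable_vecMul h.posSemidef h.integrable (continuous_trig (c n)).aemeasurable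
        (weightedNormSq_trig_ne_top h.integrable (c n)) l
    refine tendsto_integral_of_L1 _ (integrable_expo_mul hi _).1
      (Eventually.of_forall fun n => integrable_expo_mul (hin n) _) ?_
    refine (tendsto_zero_of_le_add (lintegral_ofReal_re_ne_top (h.integrable l l))
      (fun δ hδ n => lintegral_enorm_vecMul_le h.posSemidef hwm (hdm n) l hδ) hc).congr fun n => ?_
    refine lintegral_congr fun lam => ?_
    rw [← mul_sub, enorm_mul, ← ofReal_norm (expo _ _), norm_expo, ENNReal.ofReal_one, one_mul,
      enorm_sub_rev, Pi.sub_apply, Matrix.sub_vecMul, Pi.sub_apply]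

/-- The projection theorem in spectral form. If the Fourier coefficients of `u` vanish on `J` and
`uᵀ w` reproduces the covariances of `X` with the observations off `J`, then `u` is the spectral
characteristic of the best approximation of `X`, and the only one. -/
theorem exists_best_approx_spectralImage_iff (h : HasSpectralDensity P Y w)
    (hpos : ∀ᵐ lam ∂freq, (w lam).PosDef)
    (hinv : Integrable (fun lam => (w lam)⁻¹.trace) freq)
    {u : ℝ → Fin T → ℂ} (hu : AEMeasurable u freq) (hfin : weightedNormSq w u ≠ ∞)
    (J : Finset ℤ) (hJ : ∀ k ∈ J, ∀ l, ∫ lam, expo (-k) lam * u lam l ∂freq = 0)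
    {X : Ω → ℂ} (hX : MemLp X 2 P)
    (hXu : ∀ k ∉ J, ∀ l, ∫ ω, X ω * conj (Y k l ω) ∂P =
      ∫ lam, expo (-k) lam * (u lam ᵥ* w lam) l ∂freq) (v : ℝ → Fin T → ℂ) :
    (∃ Z : Lp ℂ 2 P, (Z ∈ spanOff P Y J ∧ ∀ Z' ∈ spanOff P Y J,
        eLpNorm (fun ω => X ω - Z ω) 2 P ≤ eLpNorm (fun ω => X ω - Z' ω) 2 P) ∧
      IsSpectralImage h.memLp w Z v) ↔ v =ᵐ[freq] u := by
  obtain ⟨Z, hZmem, hZu, hZinner⟩ := exists_spectralImage_mem_spanOff h hpos hinv hu hfin J hJ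
  have hnorm : ∀ V : Lp ℂ 2 P, eLpNorm (fun ω => X ω - V ω) 2 P = ‖hX.toLp X - V‖ₑ := by
    intro V
    rw [Lp.enorm_def]
    refine eLpNorm_congr_ae ?_
    filter_upwards [Lp.coeFn_sub (hX.toLp X) V, hX.coeFn_toLp] with ω h1 h2
    rw [h1, Pi.sub_apply, h2]
  have horth : ∀ V ∈ spanOff P Y J, inner ℂ V (hX.toLp X - Z) = 0 := by
    intro V hV
    refine inner_eq_zero_of_mem_spanOff h.memLp (fun k hk l => ?_) hV
    rw [inner_sub_right, hZinner, inner_toLp, hXu k hk l, sub_self]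
  have hpyth : ∀ V ∈ spanOff P Y J,
      ‖hX.toLp X - V‖ ^ 2 = ‖hX.toLp X - Z‖ ^ 2 + ‖Z - V‖ ^ 2 := by
    intro V hV
    have h0 := horth (Z - V) (Submodule.sub_mem _ hZmem hV)
    have := norm_add_sq_eq_norm_sq_add_norm_sq_of_inner_eq_zero _ _ h0
    rw [show hX.toLp X - V = (Z - V) + (hX.toLp X - Z) by abel]
    nlinarith
  simp only [hnorm]
  constructor
  · rintro ⟨Z', ⟨hZ'mem, hZ'min⟩, hZ'v⟩
    have h1 := hpyth Z' hZ'mem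
    have h2 : ‖hX.toLp X - Z'‖ ≤ ‖hX.toLp X - Z‖ := by
      have := hZ'min Z hZmem
      rwa [enorm_le_iff_norm_le] at this
    have h3 : ‖Z - Z'‖ = 0 := by
      have h4 := pow_le_pow_left₀ (norm_nonneg _) h2 2
      have h5 : ‖Z - Z'‖ ^ 2 ≤ 0 := by linarith
      exact pow_eq_zero_iff (two_ne_zero) |>.1 (le_antisymm h5 (by positivity))
    have h6 : Z = Z' := sub_eq_zero.1 (norm_eq_zero.1 h3)
    subst h6
    exact hZ'v.ae_eq h hpos hZu
  · intro hvu
    refine ⟨Z, ⟨hZmem, fun V hV => ?_⟩, hu.congr hvu.symm, fun ε hε => ?_⟩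
    · rw [enorm_le_iff_norm_le]
      have := hpyth V hV
      exact le_of_sq_le_sq (by nlinarith [sq_nonneg ‖Z - V‖]) (norm_nonneg _)
    · obtain ⟨c, hc1, hc2⟩ := hZu.2 ε hε
      refine ⟨c, ?_, hc2⟩
      rwa [weightedNormSq_congr (hvu.sub (ae_eq_refl _))]

end Isometry

/-! ### Block Toeplitz matrices of Fourier coefficients -/

section Toeplitz

variable {T : ℕ} {w : ℝ → Matrix (Fin T) (Fin T) ℂ}

lemma trigPoly_eq_trig {K : ℕ} (c : Fin K × Fin T → ℂ) :
    trigPoly c = trig (∑ x : Fin K × Fin T, Finsupp.single (((x.1 : ℕ) : ℤ), x.2) (c x)) := by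
  ext lam p
  rw [map_sum, Finset.sum_apply, Finset.sum_apply, Fintype.sum_prod_type, trigPoly]
  refine Finset.sum_congr rfl fun k _ => ?_
  simp [trig_single, Pi.single_apply]

lemma continuous_trigPoly {K : ℕ} (c : Fin K × Fin T → ℂ) : Continuous (trigPoly c) := by
  rw [trigPoly_eq_trig]; exact continuous_trig _

lemma aemeasurable_trigPoly {K : ℕ} (c : Fin K × Fin T → ℂ) : AEMeasurable (trigPoly c) freq :=
  (continuous_trigPoly c).aemeasurable

lemma weightedNormSq_trigPoly_ne_top (hw : ∀ p q, Integrable (fun lam => w lam p q) freq)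
    {K : ℕ} (c : Fin K × Fin T → ℂ) : weightedNormSq w (trigPoly c) ≠ ∞ := by
  rw [trigPoly_eq_trig]; exact weightedNormSq_trig_ne_top hw _

lemma trigPoly_sub {K : ℕ} (c c' : Fin K × Fin T → ℂ) :
    trigPoly (c - c') = trigPoly c - trigPoly c' := by
  ext lam p
  simp [trigPoly, sub_mul]

lemma integral_expo_mul_trigPoly {K : ℕ} (c : Fin K × Fin T → ℂ) (k : Fin K) (l : Fin T) :
    ∫ lam, expo (-((k : ℕ) : ℤ)) lam * trigPoly c lam l ∂freq = 2 * (Real.pi : ℂ) * c (k, l) := by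
  rw [trigPoly_eq_trig, integral_expo_mul_trig, Finsupp.finsetSum_apply,
    Finset.sum_eq_single (k, l)]
  · simp
  · rintro ⟨j, q⟩ - hne
    rw [Finsupp.single_apply, if_neg]
    intro h
    simp only [Prod.mk.injEq, Nat.cast_inj] at h
    exact hne (Prod.ext (Fin.ext h.1) h.2)
  · simp

lemma integral_expo_mul_trigPoly_of_notMem {K : ℕ} (c : Fin K × Fin T → ℂ) {k : ℤ}
    (hk : ∀ j : Fin K, ((j : ℕ) : ℤ) ≠ k) (l : Fin T) :
    ∫ lam, expo (-k) lam * trigPoly c lam l ∂freq = 0 := by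
  rw [trigPoly_eq_trig, integral_expo_mul_trig, Finsupp.finsetSum_apply,
    Finset.sum_eq_zero, mul_zero]
  rintro ⟨j, q⟩ -
  rw [Finsupp.single_apply, if_neg]
  intro h
  exact hk j (Prod.mk.inj h).1

/-- The block Toeplitz matrix of a symbol `φ` acts as multiplication by `φ` followed by taking the
Fourier coefficients. -/
lemma integral_expo_mul_mulVec_trigPoly {φ : ℝ → Matrix (Fin T) (Fin T) ℂ}
    (hφ : ∀ p q, Integrable (fun lam => φ lam p q) freq) {K : ℕ} (c : Fin K × Fin T → ℂ)
    (x : Fin K × Fin T) :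
    ∫ lam, expo (-((x.1 : ℕ) : ℤ)) lam * (φ lam *ᵥ trigPoly c lam) x.2 ∂freq =
      2 * (Real.pi : ℂ) * (fourierMatrix K φ *ᵥ c) x := by
  have hpi : (2 * (Real.pi : ℂ)) ≠ 0 := by simp [Real.pi_ne_zero]
  have key : ∀ lam, expo (-((x.1 : ℕ) : ℤ)) lam * (φ lam *ᵥ trigPoly c lam) x.2 =
      ∑ y : Fin K × Fin T, expo (((y.1 : ℕ) : ℤ) - ((x.1 : ℕ) : ℤ)) lam * φ lam x.2 y.2 * c y := by
    intro lam
    simp only [Matrix.mulVec, dotProduct, trigPoly, Finset.mul_sum, Fintype.sum_prod_type_right,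
      sub_eq_add_neg, expo_add]
    refine Finset.sum_congr rfl fun q _ => Finset.sum_congr rfl fun k _ => ?_
    ring
  simp only [key]
  rw [integral_finsetSum _ fun y _ => (integrable_expo_mul (hφ x.2 y.2) _).mul_const (c y)]
  simp only [Matrix.mulVec, dotProduct, fourierMatrix, Matrix.of_apply, Finset.mul_sum,
    integral_mul_const]
  refine Finset.sum_congr rfl fun y _ => ?_
  field_simp

lemma eq_of_integral_mulVec_trigPoly {φ : ℝ → Matrix (Fin T) (Fin T) ℂ}
    (hφ : ∀ p q, Integrable (fun lam => φ lam p q) freq) {K : ℕ} (c c' : Fin K × Fin T → ℂ)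
    (h : ∀ x : Fin K × Fin T,
      ∫ lam, expo (-((x.1 : ℕ) : ℤ)) lam * (φ lam *ᵥ trigPoly c lam) x.2 ∂freq =
        2 * (Real.pi : ℂ) * c' x) : fourierMatrix K φ *ᵥ c = c' := by
  have hpi : (2 * (Real.pi : ℂ)) ≠ 0 := by simp [Real.pi_ne_zero]
  ext x
  exact mul_left_cancel₀ hpi ((integral_expo_mul_mulVec_trigPoly hφ c x).symm.trans (h x))

lemma fourierMatrix_congr {φ ψ : ℝ → Matrix (Fin T) (Fin T) ℂ} (h : φ =ᵐ[freq] ψ) (K : ℕ) :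
    fourierMatrix K φ = fourierMatrix K ψ := by
  ext x y
  simp only [fourierMatrix, Matrix.of_apply]
  congr 1
  exact integral_congr_ae (h.mono fun lam hlam => by simp only [hlam])

/-- The block Toeplitz matrix of a positive definite symbol is injective, since its quadratic form
is a weighted norm of a trigonometric polynomial. -/
lemma isUnit_fourierMatrix_transpose {φ : ℝ → Matrix (Fin T) (Fin T) ℂ}
    (hφ : ∀ p q, Integrable (fun lam => φ lam p q) freq)
    (hpos : ∀ᵐ lam ∂freq, (φ lam).PosDef) (K : ℕ) :
    IsUnit (fourierMatrix K fun lam => (φ lam)ᵀ) := by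
  rw [← Matrix.mulVec_injective_iff_isUnit, ← Matrix.coe_mulVecLin,
    ← LinearMap.ker_eq_bot, LinearMap.ker_eq_bot']
  intro c hc
  rw [Matrix.mulVecLin_apply] at hc
  have hφm : ∀ p q, AEMeasurable (fun lam => φ lam p q) freq :=
    fun p q => (hφ p q).1.aemeasurable
  have hpsd : ∀ᵐ lam ∂freq, (φ lam).PosSemidef := hpos.mono fun _ h => h.posSemidef
  have hm := aemeasurable_trigPoly c
  have hfin := weightedNormSq_trigPoly_ne_top hφ c
  have hint : ∀ l, Integrable (fun lam => (trigPoly c lam ᵥ* φ lam) l) freq :=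
    integrable_vecMul hpsd hφ hm hfin
  have hzero : ∀ x : Fin K × Fin T,
      ∫ lam, expo (-((x.1 : ℕ) : ℤ)) lam * (trigPoly c lam ᵥ* φ lam) x.2 ∂freq = 0 := by
    intro x
    have := integral_expo_mul_mulVec_trigPoly (φ := fun lam => (φ lam)ᵀ)
      (fun p q => hφ q p) c x
    simp only [Matrix.mulVec_transpose, hc, Pi.zero_apply, mul_zero] at this
    exact this
  -- Pair the vanishing vector of Fourier coefficients with `c`.
  have hsum : ∫ lam, sesq (φ lam) (trigPoly c lam) (trigPoly c lam) ∂freq = 0 := by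
    have key : ∀ lam, sesq (φ lam) (trigPoly c lam) (trigPoly c lam) =
        ∑ x : Fin K × Fin T, conj (c x) *
          (expo (-((x.1 : ℕ) : ℤ)) lam * (trigPoly c lam ᵥ* φ lam) x.2) := by
      intro lam
      rw [sesq_eq_vecMul, Fintype.sum_prod_type_right, dotProduct]
      refine Finset.sum_congr rfl fun q _ => ?_
      simp only [trigPoly, Pi.star_apply, RCLike.star_def, map_sum, map_mul, conj_expo,
        Finset.mul_sum]
      exact Finset.sum_congr rfl fun k _ => by ring
    simp only [key]
    rw [integral_finsetSum _ fun x _ => (integrable_expo_mul (hint x.2) _).const_mul _]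
    simp only [integral_const_mul, hzero, mul_zero, Finset.sum_const_zero]
  have hint2 : Integrable (fun lam => sesq (φ lam) (trigPoly c lam) (trigPoly c lam)) freq := by
    refine ⟨(aemeasurable_sesq hφm hm hm).aestronglyMeasurable, ?_⟩
    refine lt_of_le_of_lt (lintegral_mono_ae ?_) hfin.lt_top
    filter_upwards [hpsd] with lam hlam
    rw [← ofReal_norm]
    refine ENNReal.ofReal_le_ofReal (le_of_eq ?_)
    have h1 : sesq (φ lam) (trigPoly c lam) (trigPoly c lam) =
        ((sesq (φ lam) (trigPoly c lam) (trigPoly c lam)).re : ℂ) :=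
      Complex.ext (by simp) (by simpa using sesq_self_im hlam.1 (trigPoly c lam))
    rw [h1, Complex.norm_real, Real.norm_of_nonneg (sesq_self_nonneg hlam _)]
    simp [sesq]
  have hnorm : weightedNormSq φ (trigPoly c) = 0 := by
    have hre : Integrable (fun lam => (sesq (φ lam) (trigPoly c lam) (trigPoly c lam)).re) freq :=
      hint2.re
    rw [weightedNormSq_eq_lintegral_sesq, ← ofReal_integral_eq_lintegral_ofReal hre
      (hpsd.mono fun lam hlam => sesq_self_nonneg hlam _), ENNReal.ofReal_eq_zero]
    have := integral_re hint2
    rw [hsum] at this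
    exact this.le
  have hae : trigPoly c =ᵐ[freq] 0 :=
    ae_eq_of_weightedNormSq_sub_eq_zero hφm hpos hm aemeasurable_const (by simpa using hnorm)
  ext x
  have h1 := integral_expo_mul_trigPoly c x.1 x.2
  have h2 : ∫ lam, expo (-((x.1 : ℕ) : ℤ)) lam * trigPoly c lam x.2 ∂freq = 0 := by
    refine integral_eq_zero_of_ae (hae.mono fun lam hlam => ?_)
    simp [hlam]
  rw [h2] at h1
  simpa [Real.pi_ne_zero] using h1.symm

lemma aemeasurable_det {ι : Type*} [Fintype ι] [DecidableEq ι] {A : ℝ → Matrix ι ι ℂ}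
    (hA : ∀ p q, AEMeasurable (fun lam => A lam p q) freq) :
    AEMeasurable (fun lam => (A lam).det) freq := by
  simp only [Matrix.det_apply']
  exact Finset.aemeasurable_fun_sum _ fun σ _ =>
    (Finset.aemeasurable_fun_prod _ fun i _ => hA _ _).const_mul _

lemma aemeasurable_inv_entry (hw : ∀ p q, AEMeasurable (fun lam => w lam p q) freq)
    (i j : Fin T) : AEMeasurable (fun lam => (w lam)⁻¹ i j) freq := by
  simp only [Matrix.inv_def, Matrix.smul_apply, Ring.inverse_eq_inv', Matrix.adjugate_apply,
    smul_eq_mul]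
  refine (aemeasurable_det hw).inv.mul (aemeasurable_det fun p q => ?_)
  simp only [Matrix.updateRow_apply]
  split_ifs
  · exact aemeasurable_const
  · exact hw p q

lemma integrable_inv_entry (hw : ∀ p q, AEMeasurable (fun lam => w lam p q) freq)
    (hpos : ∀ᵐ lam ∂freq, (w lam).PosDef)
    (hinv : Integrable (fun lam => (w lam)⁻¹.trace) freq) (i j : Fin T) :
    Integrable (fun lam => (w lam)⁻¹ i j) freq := by
  refine Integrable.mono' (hinv.re.add hinv.re)
    (aemeasurable_inv_entry hw i j).aestronglyMeasurable ?_
  filter_upwards [hpos] with lam hlam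
  exact norm_entry_le_of_posSemidef hlam.inv.posSemidef i j

lemma sesq_vecMul_inv {A : Matrix (Fin T) (Fin T) ℂ} (hA : A.PosDef) (u : Fin T → ℂ) :
    sesq A (u ᵥ* A⁻¹) (u ᵥ* A⁻¹) = sesq A⁻¹ u u := by
  have hdet : IsUnit A.det := (Matrix.isUnit_iff_isUnit_det A).1 hA.isUnit
  rw [sesq_eq_vecMul, Matrix.vecMul_vecMul, Matrix.nonsing_inv_mul _ hdet, Matrix.vecMul_one,
    Matrix.star_vecMul, hA.inv.1.eq, sesq]

end Toeplitz

/-! ### Interpolation of a stationary sequence -/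

section Interpolation

variable {Ω : Type*} [MeasurableSpace Ω] {P : Measure Ω} {T : ℕ} {Y : ℤ → Fin T → Ω → ℂ}
  {w : ℝ → Matrix (Fin T) (Fin T) ℂ}

/-- `v` represents, in the weighted space of `w`, the projection of `X` to the closed span of the
whole sequence `Y`: it reproduces the covariances of `X` with `Y`. -/
structure IsProjectionSymbol (P : Measure Ω) (Y : ℤ → Fin T → Ω → ℂ)
    (w : ℝ → Matrix (Fin T) (Fin T) ℂ) (X : Ω → ℂ) (v : ℝ → Fin T → ℂ) : Prop where
  memLp : MemLp X 2 P
  aemeasurable : AEMeasurable v freq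
  ne_top : weightedNormSq w v ≠ ∞
  covariance : ∀ k l, ∫ ω, X ω * conj (Y k l ω) ∂P =
    ∫ lam, expo (-k) lam * (v lam ᵥ* w lam) l ∂freq

lemma IsProjectionSymbol.sub (h : HasSpectralDensity P Y w) {X X' : Ω → ℂ} {v v' : ℝ → Fin T → ℂ}
    (hX : IsProjectionSymbol P Y w X v) (hX' : IsProjectionSymbol P Y w X' v') :
    IsProjectionSymbol P Y w (X - X') (v - v') where
  memLp := hX.memLp.sub hX'.memLp
  aemeasurable := hX.aemeasurable.sub hX'.aemeasurable
  ne_top := by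
    refine ((weightedNormSq_sub_le (fun p q => (h.integrable p q).1.aemeasurable) h.posSemidef
      hX.aemeasurable).trans_lt ?_).ne
    exact ENNReal.add_lt_top.2 ⟨ENNReal.mul_lt_top (by simp) hX.ne_top.lt_top,
      ENNReal.mul_lt_top (by simp) hX'.ne_top.lt_top⟩
  covariance := fun k l => by
    have hY : MemLp (fun ω => conj (Y k l ω)) 2 P := (h.memLp k l).star
    have hi : Integrable (fun ω => X ω * conj (Y k l ω)) P := hX.memLp.integrable_mul hY
    have hi' : Integrable (fun ω => X' ω * conj (Y k l ω)) P := hX'.memLp.integrable_mul hY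
    simp only [Pi.sub_apply, sub_mul, Matrix.sub_vecMul, mul_sub]
    rw [integral_sub hi hi',
      integral_sub
        (integrable_expo_mul (integrable_vecMul h.posSemidef h.integrable hX.aemeasurable
          hX.ne_top l) _)
        (integrable_expo_mul (integrable_vecMul h.posSemidef h.integrable hX'.aemeasurable
          hX'.ne_top l) _), hX.covariance, hX'.covariance]

/-- Interpolation of `X` when `Y` is not observed at the times `0, …, K - 1`. The spectral
characteristic differs from the projection symbol `v` by `w⁻¹` times a trigonometric polynomial with
frequencies `0, …, K - 1`, since the error is orthogonal to the observations; the coefficients solve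
a block Toeplitz system, since the spectral characteristic has no Fourier coefficients there. -/
theorem interpolation_iff (h : HasSpectralDensity P Y w)
    (hpos : ∀ᵐ lam ∂freq, (w lam).PosDef)
    (hinv : Integrable (fun lam => (w lam)⁻¹.trace) freq)
    {X : Ω → ℂ} {v : ℝ → Fin T → ℂ} (hX : IsProjectionSymbol P Y w X v) {K : ℕ}
    {c q : Fin K × Fin T → ℂ}
    (hq : ∀ x : Fin K × Fin T,
      ∫ lam, expo (-((x.1 : ℕ) : ℤ)) lam * v lam x.2 ∂freq = 2 * (Real.pi : ℂ) * q x)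
    (hc : fourierMatrix K (fun lam => ((w lam)⁻¹)ᵀ) *ᵥ c = q) (u : ℝ → Fin T → ℂ) :
    (∃ Z : Lp ℂ 2 P, (Z ∈ spanOff P Y (Finset.Ico 0 (K : ℤ)) ∧
        ∀ Z' ∈ spanOff P Y (Finset.Ico 0 (K : ℤ)),
          eLpNorm (fun ω => X ω - Z ω) 2 P ≤ eLpNorm (fun ω => X ω - Z' ω) 2 P) ∧
      IsSpectralImage h.memLp w Z u) ↔
      u =ᵐ[freq] fun lam => v lam - trigPoly c lam ᵥ* (w lam)⁻¹ := by
  have hwm : ∀ p q, AEMeasurable (fun lam => w lam p q) freq :=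
    fun p q => (h.integrable p q).1.aemeasurable
  have hinvI := integrable_inv_entry hwm hpos hinv
  set C : ℝ → Fin T → ℂ := fun lam => trigPoly c lam ᵥ* (w lam)⁻¹ with hC
  have hCm : AEMeasurable C freq :=
    aemeasurable_vecMul (aemeasurable_inv_entry hwm) (aemeasurable_trigPoly c)
  have hCfin : weightedNormSq w C ≠ ∞ := by
    have : weightedNormSq w C = weightedNormSq (fun lam => (w lam)⁻¹) (trigPoly c) := by
      simp only [weightedNormSq_eq_lintegral_sesq]
      refine lintegral_congr_ae (hpos.mono fun lam hlam => ?_)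
      simp only [hC]
      rw [sesq_vecMul_inv hlam]
    rw [this]
    exact weightedNormSq_trigPoly_ne_top hinvI c
  have hfin : weightedNormSq w (v - C) ≠ ∞ := by
    refine ((weightedNormSq_sub_le hwm h.posSemidef hX.aemeasurable).trans_lt ?_).ne
    exact ENNReal.add_lt_top.2 ⟨ENNReal.mul_lt_top (by simp) hX.ne_top.lt_top,
      ENNReal.mul_lt_top (by simp) hCfin.lt_top⟩
  have hvI := integrable_apply hpos h.integrable hinv hX.aemeasurable hX.ne_top
  have hCI := integrable_apply hpos h.integrable hinv hCm hCfin
  refine exists_best_approx_spectralImage_iff h hpos hinv (hX.aemeasurable.sub hCm) hfin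
    (Finset.Ico 0 (K : ℤ)) (fun k hk l => ?_) hX.memLp (fun k hk l => ?_) u
  · obtain ⟨hk0, hkK⟩ := Finset.mem_Ico.1 hk
    lift k to ℕ using hk0
    have hkK' : k < K := by exact_mod_cast hkK
    have h1 := hq (⟨k, hkK'⟩, l)
    have h2 := integral_expo_mul_mulVec_trigPoly (φ := fun lam => ((w lam)⁻¹)ᵀ)
      (fun p q => hinvI q p) c (⟨k, hkK'⟩, l)
    simp only [Matrix.mulVec_transpose] at h2
    simp only [Pi.sub_apply, mul_sub]
    rw [integral_sub (integrable_expo_mul (hvI l) _) (integrable_expo_mul (hCI l) _), h1, h2, hc,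
      sub_self]
  · rw [hX.covariance]
    have h1 : ∫ lam, expo (-k) lam * (C lam ᵥ* w lam) l ∂freq = 0 := by
      rw [← integral_expo_mul_trigPoly_of_notMem c (k := k) (fun j hj => hk ?_) l]
      · refine integral_congr_ae (hpos.mono fun lam hlam => ?_)
        have hdet : IsUnit (w lam).det := (Matrix.isUnit_iff_isUnit_det _).1 hlam.isUnit
        simp only [hC, Matrix.vecMul_vecMul, Matrix.nonsing_inv_mul _ hdet, Matrix.vecMul_one]
      · rw [← hj, Finset.mem_Ico]
        exact ⟨by positivity, by exact_mod_cast j.2⟩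
    simp only [Pi.sub_apply, Matrix.sub_vecMul, mul_sub]
    rw [integral_sub
      (integrable_expo_mul (integrable_vecMul h.posSemidef h.integrable hX.aemeasurable
        hX.ne_top l) _)
      (integrable_expo_mul (integrable_vecMul h.posSemidef h.integrable hCm hCfin l) _),
      h1, sub_zero]

end Interpolation

/-! ### The symbols of the increment operator -/

section Symbols

variable {r : ℕ} {μ s d : Fin r → ℕ}

lemma expo_sum {ι : Type*} (S : Finset ι) (k : ι → ℤ) (lam : ℝ) :
    expo (∑ i ∈ S, k i) lam = ∏ i ∈ S, expo (k i) lam := by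
  classical
  induction S using Finset.induction_on with
  | empty => simp [expo_zero]
  | insert i S hi ih => rw [Finset.sum_insert hi, Finset.prod_insert hi, expo_add, ih]

lemma chi_eq_sum (μ s d : Fin r → ℕ) (lam : ℝ) :
    chi μ s d lam = ∑ l ∈ Fintype.piFinset (fun i => Finset.range (d i + 1)),
      (∏ i, (-1 : ℂ) ^ l i * ((d i).choose (l i) : ℂ)) *
        expo (-∑ i, ((μ i * s i * l i : ℕ) : ℤ)) lam := by
  have h1 : ∀ j, (1 - expo (-((μ j * s j : ℕ) : ℤ)) lam) ^ d j =
      ∑ l ∈ Finset.range (d j + 1), ((-1 : ℂ) ^ l * ((d j).choose l : ℂ)) *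
        expo (-((μ j * s j * l : ℕ) : ℤ)) lam := by
    intro j
    rw [sub_eq_add_neg, add_comm, add_pow]
    refine Finset.sum_congr rfl fun l _ => ?_
    rw [expo_natCast_mul (μ j * s j) l, one_pow, mul_one, neg_pow]
    ring
  simp only [chi, h1]
  rw [Finset.prod_univ_sum]
  refine Finset.sum_congr rfl fun l _ => ?_
  rw [Finset.prod_mul_distrib, ← Finset.sum_neg_distrib, expo_sum]

@[fun_prop]
lemma continuous_chi : Continuous (chi μ s d) := by
  unfold chi; fun_prop

@[fun_prop]
lemma continuous_beta : Continuous (beta s d) := by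
  unfold beta; fun_prop

lemma ae_notMem_range_int (φ : ℤ → ℝ) : ∀ᵐ lam ∂freq, lam ∉ Set.range φ :=
  ae_restrict_of_ae ((Set.countable_range φ).ae_notMem volume)

lemma chi_ne_zero (hμ : ∀ i, 0 < μ i) (hs : ∀ i, 0 < s i) : ∀ᵐ lam ∂freq, chi μ s d lam ≠ 0 := by
  have h : ∀ j : Fin r, ∀ᵐ lam ∂freq,
      lam ∉ Set.range fun k : ℤ => -(k * (2 * Real.pi)) / ((μ j * s j : ℕ) : ℝ) :=
    fun j => ae_notMem_range_int _
  filter_upwards [ae_all_iff.2 h] with lam hlam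
  refine Finset.prod_ne_zero_iff.2 fun j _ => pow_ne_zero _ fun h0 => ?_
  have h1 : expo (-((μ j * s j : ℕ) : ℤ)) lam = 1 := (sub_eq_zero.1 h0).symm
  rw [expo, Complex.exp_eq_one_iff] at h1
  obtain ⟨k, hk⟩ := h1
  refine hlam j ⟨k, ?_⟩
  have hm : (((μ j * s j : ℕ) : ℝ)) ≠ 0 := by
    exact_mod_cast (Nat.mul_pos (hμ j) (hs j)).ne'
  have h2 : Complex.I * (((k * (2 * Real.pi) + (μ j * s j : ℕ) * lam : ℝ)) : ℂ) = 0 := by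
    push_cast at hk ⊢
    linear_combination -hk
  have h3 : k * (2 * Real.pi) + ((μ j * s j : ℕ) : ℝ) * lam = 0 := by
    have := (mul_eq_zero.1 h2).resolve_left Complex.I_ne_zero
    exact_mod_cast this
  simp only
  rw [div_eq_iff hm]
  linarith

lemma beta_ne_zero : ∀ᵐ lam ∂freq, beta s d lam ≠ 0 := by
  have h : ∀ j : Fin r, ∀ᵐ lam ∂freq,
      lam ∉ Set.range fun k : ℤ => 2 * Real.pi * k / (s j : ℝ) :=
    fun j => ae_notMem_range_int _
  filter_upwards [ae_all_iff.2 h] with lam hlam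
  refine Finset.prod_ne_zero_iff.2 fun j _ => Finset.prod_ne_zero_iff.2 fun k _ =>
    pow_ne_zero _ fun h0 => hlam j ⟨k, ?_⟩
  have h2 : Complex.I * ((lam - 2 * Real.pi * k / (s j : ℝ) : ℝ) : ℂ) = 0 := by
    push_cast
    rw [← h0]; ring
  have h3 := (mul_eq_zero.1 h2).resolve_left Complex.I_ne_zero
  have h4 : lam - 2 * Real.pi * k / (s j : ℝ) = 0 := by exact_mod_cast h3
  simp only
  linarith

/-- The polynomial `∏ (1 - x^{μ_i s_i})^{d_i}` with coefficients `eCoeff`. -/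
lemma sum_eCoeff_mul_pow (μ s d : Fin r → ℕ) (z : ℂ) :
    ∑ k ∈ Finset.range (degree μ s d + 1), eCoeff μ s d k * z ^ k =
      ∏ i, (1 - z ^ (μ i * s i)) ^ d i := by
  set q : Polynomial ℂ := ∏ i, ((1 : Polynomial ℂ) - Polynomial.X ^ (μ i * s i)) ^ d i with hq
  have hdeg : q.natDegree < degree μ s d + 1 := by
    refine Nat.lt_succ_of_le ((Polynomial.natDegree_prod_le _ _).trans
      (Finset.sum_le_sum fun i _ => ?_))
    refine Polynomial.natDegree_pow_le.trans ?_
    rw [mul_comm (d i)]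
    refine Nat.mul_le_mul_right _ ((Polynomial.natDegree_sub_le _ _).trans ?_)
    simp
  have h := Polynomial.eval_eq_sum_range' hdeg z
  have h2 : q.eval z = ∏ i, (1 - z ^ (μ i * s i)) ^ d i := by
    simp [hq, Polynomial.eval_prod]
  rw [← h2, h]
  rfl

lemma expo_one_pow (k : ℕ) (lam : ℝ) : expo 1 lam ^ k = expo (k : ℤ) lam := by
  induction k with
  | zero => simp [expo_zero]
  | succ k ih => rw [pow_succ, ih, ← expo_add]; simp

lemma expo_neg_one_pow (k : ℕ) (lam : ℝ) : expo (-1) lam ^ k = expo (-(k : ℤ)) lam := by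
  have := expo_natCast_mul 1 k lam
  simpa using this.symm

lemma chi_eq_sum_eCoeff (μ s d : Fin r → ℕ) (lam : ℝ) :
    chi μ s d lam =
      ∑ k ∈ Finset.range (degree μ s d + 1), eCoeff μ s d k * expo (-(k : ℤ)) lam := by
  simp only [← expo_neg_one_pow]
  rw [sum_eCoeff_mul_pow]
  simp only [expo_neg_one_pow, chi]

/-- `conj χ = χ(e^{iλ})` agrees up to sign with `e^{inλ} χ(e^{-iλ})`: the polynomial
`∏ (1 - x^{μ_i s_i})^{d_i}` is reciprocal up to sign. -/
lemma expo_degree_mul_chi (μ s d : Fin r → ℕ) (lam : ℝ) :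
    expo (degree μ s d : ℤ) lam * chi μ s d lam = (-1) ^ (∑ i, d i) * conj (chi μ s d lam) := by
  have h1 : expo (degree μ s d : ℤ) lam = ∏ i, expo ((μ i * s i : ℕ) : ℤ) lam ^ d i := by
    rw [degree, ← expo_one_pow, ← Finset.prod_pow_eq_pow_sum]
    refine Finset.prod_congr rfl fun i _ => ?_
    rw [← expo_one_pow, pow_mul]
  rw [h1, chi, map_prod, ← Finset.prod_pow_eq_pow_sum, ← Finset.prod_mul_distrib,
    ← Finset.prod_mul_distrib]
  refine Finset.prod_congr rfl fun i _ => ?_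
  rw [map_pow, ← mul_pow, ← mul_pow, map_sub, map_one, conj_expo, neg_neg, mul_sub, ← expo_add,
    add_neg_cancel, expo_zero]
  ring

end Symbols

section Stack

variable {r T : ℕ}

lemma trigPoly_stack (K : ℕ) (v : ℕ → Fin T → ℂ) (lam : ℝ) (p : Fin T) :
    trigPoly (stack K v) lam p = ∑ k ∈ Finset.range K, v k p * expo (k : ℤ) lam := by
  simp only [trigPoly, stack]
  exact Fin.sum_univ_eq_sum_range (fun k => v k p * expo (k : ℤ) lam) K

lemma trigPoly_padded (N n : ℕ) (v : ℕ → Fin T → ℂ) :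
    trigPoly (padded N n v) = trigPoly (stack (N + 1) v) := by
  ext lam p
  rw [padded, trigPoly_stack, trigPoly_stack]
  symm
  refine Finset.sum_subset_zero_on_sdiff (Finset.range_mono (by omega)) (fun k hk => ?_)
    fun k hk => ?_
  · have : ¬ k ≤ N := by
      simp only [Finset.mem_sdiff, Finset.mem_range] at hk; omega
    simp [this]
  · have : k ≤ N := by
      simp only [Finset.mem_range] at hk; omega
    simp [this]

/-- `conj χ` times `∑ a(k) e^{ikλ}` is, up to sign, the polynomial with coefficients `aMu`. -/
lemma trigPoly_aMu (μ s d : Fin r → ℕ) (N : ℕ) (a : ℕ → Fin T → ℂ) (lam : ℝ) :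
    (-1 : ℂ) ^ (∑ i, d i) • trigPoly (stack (N + degree μ s d + 1) (aMu μ s d N a)) lam =
      conj (chi μ s d lam) • trigPoly (stack (N + 1) a) lam := by
  set n := degree μ s d with hn
  have hsign : (-1 : ℂ) ^ (∑ i, d i) * (-1 : ℂ) ^ (∑ i, d i) = 1 := by
    rw [← mul_pow]; simp
  have key : trigPoly (stack (N + n + 1) (aMu μ s d N a)) lam =
      (expo (n : ℤ) lam * chi μ s d lam) • trigPoly (stack (N + 1) a) lam := by
    ext p
    rw [Pi.smul_apply, trigPoly_stack, trigPoly_stack, chi_eq_sum_eCoeff, ← hn]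
    simp only [aMu, ← hn, Finset.sum_mul]
    rw [Finset.sum_comm' (t' := Finset.range (N + 1)) (s' := fun l => Finset.Icc l (l + n))
      (by intro m l; simp only [Finset.mem_range, Finset.mem_Icc, le_min_iff]; omega),
      smul_eq_mul, Finset.mul_sum]
    refine Finset.sum_congr rfl fun l _ => ?_
    rw [Finset.mul_sum, Finset.sum_mul]
    -- For fixed `l` the powers `l ≤ m ≤ l + n` are reversed by `k = l + n - m`.
    refine Finset.sum_bij' (fun m _ => l + n - m) (fun k _ => l + n - k) ?_ ?_ ?_ ?_ ?_
    · intro m hm; simp only [Finset.mem_Icc, Finset.mem_range] at hm ⊢; omega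
    · intro k hk; simp only [Finset.mem_Icc, Finset.mem_range] at hk ⊢; omega
    · intro m hm; simp only [Finset.mem_Icc] at hm; omega
    · intro k hk; simp only [Finset.mem_range] at hk; omega
    · intro m hm
      simp only [Finset.mem_Icc] at hm
      have h1 : (m : ℤ) = n + -((l + n - m : ℕ) : ℤ) + l := by omega
      rw [h1, expo_add, expo_add]
      ring
  rw [key, smul_smul, expo_degree_mul_chi, ← mul_assoc, hsign, one_mul]

lemma increment_add {Ω : Type*} (μ s d : Fin r → ℕ) (X X' : ℤ → Fin T → Ω → ℂ) :
    increment μ s d (X + X') = increment μ s d X + increment μ s d X' := by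
  ext m p ω
  simp [increment, mul_add, Finset.sum_add_distrib]

end Stack

/-! ### Covariances of the increments -/

section Covariance

variable {Ω : Type*} [MeasurableSpace Ω] {P : Measure Ω} {r T : ℕ} {μ s d : Fin r → ℕ}

lemma memLp_increment {X : ℤ → Fin T → Ω → ℂ} (hX : ∀ m p, MemLp (X m p) 2 P) (m : ℤ) (p : Fin T) :
    MemLp (increment μ s d X m p) 2 P :=
  memLp_finsetSum _ fun _ _ => (hX _ p).const_mul _

lemma integrable_mul_conj {X V : Ω → ℂ} (hX : MemLp X 2 P) (hV : MemLp V 2 P) :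
    Integrable (fun ω => X ω * conj (V ω)) P := by
  have hV' : MemLp (fun ω => conj (V ω)) 2 P := hV.star
  exact hX.integrable_mul hV'

lemma integral_mul_conj_comm (X V : Ω → ℂ) :
    ∫ ω, V ω * conj (X ω) ∂P = conj (∫ ω, X ω * conj (V ω) ∂P) := by
  rw [← integral_conj]
  simp [mul_comm]

/-- Taking increments multiplies a cross-spectral density by `χ(e^{-iλ})`. -/
lemma covariance_increment {X : ℤ → Fin T → Ω → ℂ} (hX : ∀ m p, MemLp (X m p) 2 P) {V : Ω → ℂ}
    (hV : MemLp V 2 P) {p : Fin T} {φ : ℝ → ℂ} (hφ : Integrable φ freq) {j : ℤ}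
    (h : ∀ k, ∫ ω, X k p ω * conj (V ω) ∂P = ∫ lam, expo (k - j) lam * φ lam ∂freq) (k : ℤ) :
    ∫ ω, increment μ s d X k p ω * conj (V ω) ∂P =
      ∫ lam, expo (k - j) lam * (chi μ s d lam * φ lam) ∂freq := by
  simp only [increment, chi_eq_sum, Finset.sum_mul, Finset.mul_sum, mul_assoc]
  rw [integral_finsetSum _ fun l _ => (integrable_mul_conj (hX _ p) hV).const_mul _,
    integral_finsetSum]
  · refine Finset.sum_congr rfl fun l _ => ?_
    rw [integral_const_mul, h, ← integral_const_mul]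
    refine integral_congr_ae (Eventually.of_forall fun lam => ?_)
    simp only [sub_eq_add_neg, expo_add]
    ring
  · exact fun l _ => integrable_expo_mul ((integrable_expo_mul hφ _).const_mul _) _

lemma integrable_conj {φ : ℝ → ℂ} (hφ : Integrable φ freq) :
    Integrable (fun lam => conj (φ lam)) freq :=
  Complex.conjCLE.toContinuousLinearMap.integrable_comp hφ

lemma integrable_chi_mul {φ : ℝ → ℂ} (hφ : Integrable φ freq) :
    Integrable (fun lam => chi μ s d lam * φ lam) freq := by
  obtain ⟨C, hC⟩ := (isCompact_Icc (a := -Real.pi) (b := Real.pi)).exists_bound_of_continuousOn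
    (continuous_chi (μ := μ) (s := s) (d := d)).continuousOn
  refine hφ.bdd_mul (c := C) continuous_chi.aestronglyMeasurable ?_
  filter_upwards [ae_restrict_mem measurableSet_Ico] with lam hlam
  exact hC lam (Set.Ico_subset_Icc_self hlam)

/-- The cross-spectral density of the increments of a stationary sequence and the sequence. -/
lemma covariance_increment_self {η : ℤ → Fin T → Ω → ℂ} {g : ℝ → Matrix (Fin T) (Fin T) ℂ}
    (hη : HasSpectralDensity P η g) (k j : ℤ) (p q : Fin T) :
    ∫ ω, increment μ s d η k p ω * conj (η j q ω) ∂P =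
      ∫ lam, expo (k - j) lam * (chi μ s d lam * g lam p q) ∂freq := by
  refine covariance_increment hη.memLp (hη.memLp j q) (hη.integrable p q) (fun k => ?_) k
  have := hη.covariance (k - j) j p q
  rwa [add_sub_cancel] at this

/-- The spectral density of the increments of a stationary sequence is `|χ|²` times its own. -/
lemma covariance_increment_increment {η : ℤ → Fin T → Ω → ℂ} {g : ℝ → Matrix (Fin T) (Fin T) ℂ}
    (hη : HasSpectralDensity P η g) (k j : ℤ) (p q : Fin T) :
    ∫ ω, increment μ s d η k p ω * conj (increment μ s d η j q ω) ∂P =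
      ∫ lam, expo (k - j) lam * (((‖chi μ s d lam‖ ^ 2 : ℝ) : ℂ) * g lam p q) ∂freq := by
  have h := covariance_increment (μ := μ) (s := s) (d := d) (p := q) (j := k)
    (φ := fun lam => conj (chi μ s d lam * g lam p q)) hη.memLp
    (memLp_increment (μ := μ) (s := s) (d := d) hη.memLp k p)
    (integrable_conj (integrable_chi_mul (hη.integrable p q))) (fun m => by
      rw [integral_mul_conj_comm, covariance_increment_self hη, ← integral_conj]
      simp only [map_mul, conj_expo, neg_sub]) j
  rw [integral_mul_conj_comm, h, ← integral_conj]
  refine integral_congr_ae (Eventually.of_forall fun lam => ?_)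
  simp only [map_mul, conj_expo, neg_sub, Complex.conj_conj]
  rw [← Complex.normSq_eq_norm_sq, ← Complex.mul_conj]
  ring

/-- The spectral density `|χ|² |β|⁻² f + |χ|² g` of the observed increments. -/
noncomputable def incrementDensity (μ s d : Fin r → ℕ) (f g : ℝ → Matrix (Fin T) (Fin T) ℂ)
    (lam : ℝ) : Matrix (Fin T) (Fin T) ℂ :=
  ((‖chi μ s d lam‖ ^ 2 / ‖beta s d lam‖ ^ 2 : ℝ) : ℂ) • f lam +
    ((‖chi μ s d lam‖ ^ 2 : ℝ) : ℂ) • g lam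

variable {ξ η : ℤ → Fin T → Ω → ℂ} {f g : ℝ → Matrix (Fin T) (Fin T) ℂ}

lemma posSemidef_ofReal_smul {A : Matrix (Fin T) (Fin T) ℂ} (hA : A.PosSemidef) {b : ℝ}
    (hb : 0 ≤ b) : ((b : ℂ) • A).PosSemidef :=
  hA.smul (by exact_mod_cast hb)

lemma covariance_increment_eq_zero (hξ : HasIncrementSpectralDensity P μ s d ξ f)
    (hη : HasSpectralDensity P η g) (hξη : IncrementsUncorrelated P μ s d ξ η) (k j : ℤ)
    (p q : Fin T) :
    ∫ ω, increment μ s d η k p ω * conj (increment μ s d ξ j q ω) ∂P = 0 := by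
  rw [covariance_increment (φ := fun _ => 0) (j := 0) hη.memLp (hξ.memLp j q) (by simp)
    (fun k => by rw [integral_mul_conj_comm, hξη]; simp)]
  simp

lemma hasSpectralDensity_increment_add [IsFiniteMeasure P]
    (hξ : HasIncrementSpectralDensity P μ s d ξ f)
    (hη : HasSpectralDensity P η g) (hξη : IncrementsUncorrelated P μ s d ξ η) :
    HasSpectralDensity P (increment μ s d (ξ + η)) (incrementDensity μ s d f g) := by
  have hηm := memLp_increment (μ := μ) (s := s) (d := d) hη.memLp
  have hχg : ∀ p q, Integrable (fun lam => ((‖chi μ s d lam‖ ^ 2 : ℝ) : ℂ) * g lam p q) freq := by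
    intro p q
    have := integrable_chi_mul (μ := μ) (s := s) (d := d) (integrable_conj
      (integrable_chi_mul (μ := μ) (s := s) (d := d) (integrable_conj (hη.integrable p q))))
    refine this.congr (Eventually.of_forall fun lam => ?_)
    simp only [map_mul, Complex.conj_conj]
    rw [← Complex.normSq_eq_norm_sq, ← Complex.mul_conj]
    ring
  have hadd : ∀ m p ω, increment μ s d (ξ + η) m p ω =
      increment μ s d ξ m p ω + increment μ s d η m p ω := by
    intro m p ω; rw [increment_add μ s d]; rfl
  refine ⟨fun m p => ?_, fun m p => ?_, ?_, fun p q => ?_, fun k m p q => ?_⟩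
  · rw [increment_add μ s d]; exact (hξ.memLp m p).add (hηm m p)
  · have hmean : ∫ ω, increment μ s d η m p ω ∂P = 0 := by
      simp only [increment]
      rw [integral_finsetSum _ fun l _ => ((hη.memLp _ p).integrable one_le_two).const_mul _]
      simp only [integral_const_mul, hη.mean_zero, mul_zero, Finset.sum_const_zero]
    simp only [hadd]
    rw [integral_add ((hξ.memLp m p).integrable one_le_two) ((hηm m p).integrable one_le_two),
      hξ.mean_zero, hmean, add_zero]
  · filter_upwards [hξ.posSemidef, hη.posSemidef] with lam h1 h2
    exact h1.add (posSemidef_ofReal_smul h2 (by positivity))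
  · exact (hξ.integrable p q).add (hχg p q)
  · simp only [hadd, map_add, add_mul, mul_add]
    have h1 := integrable_mul_conj (hξ.memLp (m + k) p) (hξ.memLp m q)
    have h2 := integrable_mul_conj (hξ.memLp (m + k) p) (hηm m q)
    have h3 := integrable_mul_conj (hηm (m + k) p) (hξ.memLp m q)
    have h4 := integrable_mul_conj (hηm (m + k) p) (hηm m q)
    refine (integral_add (h1.add h3) (h2.add h4)).trans ((congrArg₂ (· + ·) (integral_add h1 h3)
      (integral_add h2 h4)).trans ?_)
    rw [hξ.covariance, covariance_increment_eq_zero hξ hη hξη,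
      integral_mul_conj_comm (increment μ s d η m q), covariance_increment_eq_zero hξ hη hξη,
      covariance_increment_increment hη, map_zero, add_zero, zero_add, add_sub_cancel_left,
      ← integral_add (integrable_expo_mul (hξ.integrable p q) k) (integrable_expo_mul (hχg p q) k)]
    simp [incrementDensity, mul_add]

/-- Covariances of a linear functional in spectral terms. -/
lemma covariance_functional {Z : ℤ → Fin T → Ω → ℂ} (hZ : ∀ m p, MemLp (Z m p) 2 P) {V : Ω → ℂ}
    (hV : MemLp V 2 P) {φ : ℝ → Fin T → ℂ} (hφ : ∀ p, Integrable (fun lam => φ lam p) freq) {j : ℤ}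
    (h : ∀ k p, ∫ ω, Z k p ω * conj (V ω) ∂P = ∫ lam, expo (k - j) lam * φ lam p ∂freq)
    (N : ℕ) (a : ℕ → Fin T → ℂ) :
    ∫ ω, functional N a Z ω * conj (V ω) ∂P =
      ∫ lam, expo (-j) lam * (trigPoly (stack (N + 1) a) lam ⬝ᵥ φ lam) ∂freq := by
  have key : ∀ lam, expo (-j) lam * (trigPoly (stack (N + 1) a) lam ⬝ᵥ φ lam) =
      ∑ k ∈ Finset.range (N + 1), ∑ p, a k p * (expo (k - j) lam * φ lam p) := by
    intro lam
    simp only [dotProduct, trigPoly_stack, Finset.sum_mul, Finset.mul_sum]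
    rw [Finset.sum_comm]
    refine Finset.sum_congr rfl fun k _ => Finset.sum_congr rfl fun p _ => ?_
    rw [sub_eq_add_neg, expo_add]
    ring
  have hi : ∀ (k : ℕ) p, Integrable (fun ω => a k p * (Z k p ω * conj (V ω))) P := fun k p =>
    (integrable_mul_conj (hZ k p) hV).const_mul _
  have hi' : ∀ (k : ℕ) p, Integrable (fun lam => a k p * (expo (k - j) lam * φ lam p)) freq :=
    fun k p => (integrable_expo_mul (hφ p) _).const_mul _
  simp only [key, functional, Finset.sum_mul, mul_assoc]
  rw [integral_finsetSum _ fun k _ => integrable_finsetSum _ fun p _ => hi k p,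
    integral_finsetSum _ fun k _ => integrable_finsetSum _ fun p _ => hi' k p]
  refine Finset.sum_congr rfl fun k _ => ?_
  rw [integral_finsetSum _ fun p _ => hi k p, integral_finsetSum _ fun p _ => hi' k p]
  refine Finset.sum_congr rfl fun p _ => ?_
  rw [integral_const_mul, integral_const_mul, h]

end Covariance

/-! ### The observed sequence and the two functionals -/

section Observed

variable {Ω : Type*} [MeasurableSpace Ω] {P : Measure Ω} {r T : ℕ} {μ s d : Fin r → ℕ}
  {ξ η : ℤ → Fin T → Ω → ℂ} {f g : ℝ → Matrix (Fin T) (Fin T) ℂ}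

lemma incrementDensity_eq_smul {lam : ℝ} (hβ : beta s d lam ≠ 0) :
    incrementDensity μ s d f g lam =
      ((‖chi μ s d lam‖ ^ 2 / ‖beta s d lam‖ ^ 2 : ℝ) : ℂ) • obsDensity s d f g lam := by
  have hb : (‖beta s d lam‖ : ℂ) ≠ 0 := by simpa using hβ
  rw [incrementDensity, obsDensity, smul_add, smul_smul]
  congr 2
  push_cast
  field_simp

lemma inv_incrementDensity {lam : ℝ} (hβ : beta s d lam ≠ 0) (hχ : chi μ s d lam ≠ 0)
    (hp : IsUnit (obsDensity s d f g lam)) :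
    (incrementDensity μ s d f g lam)⁻¹ =
      ((‖beta s d lam‖ ^ 2 / ‖chi μ s d lam‖ ^ 2 : ℝ) : ℂ) • (obsDensity s d f g lam)⁻¹ := by
  have hb : (‖beta s d lam‖ : ℂ) ≠ 0 := by simpa using hβ
  have hc : (‖chi μ s d lam‖ : ℂ) ≠ 0 := by simpa using hχ
  rw [incrementDensity_eq_smul hβ]
  refine Matrix.inv_eq_right_inv ?_
  rw [Matrix.smul_mul, Matrix.mul_smul, smul_smul,
    Matrix.mul_nonsing_inv _ ((Matrix.isUnit_iff_isUnit_det _).1 hp)]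
  convert one_smul ℂ (1 : Matrix (Fin T) (Fin T) ℂ) using 2
  push_cast
  field_simp

lemma ae_regular (hμ : ∀ i, 0 < μ i) (hs : ∀ i, 0 < s i) (hmin : Minimality μ s d f g) :
    ∀ᵐ lam ∂freq, beta s d lam ≠ 0 ∧ chi μ s d lam ≠ 0 ∧ IsUnit (obsDensity s d f g lam) := by
  filter_upwards [beta_ne_zero (s := s) (d := d), chi_ne_zero (d := d) hμ hs, hmin.1]
    with lam h1 h2 h3
  exact ⟨h1, h2, h3⟩

lemma posDef_incrementDensity (hμ : ∀ i, 0 < μ i) (hs : ∀ i, 0 < s i)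
    (hmin : Minimality μ s d f g)
    (hpsd : ∀ᵐ lam ∂freq, (incrementDensity μ s d f g lam).PosSemidef) :
    ∀ᵐ lam ∂freq, (incrementDensity μ s d f g lam).PosDef := by
  filter_upwards [ae_regular hμ hs hmin, hpsd] with lam ⟨hβ, hχ, hp⟩ h
  refine h.posDef_iff_isUnit.2 ?_
  rw [incrementDensity_eq_smul hβ, Matrix.isUnit_iff_isUnit_det, Matrix.det_smul]
  refine IsUnit.mul (IsUnit.mk0 _ (pow_ne_zero _ ?_)) ((Matrix.isUnit_iff_isUnit_det _).1 hp)
  rw [Complex.ofReal_ne_zero]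
  exact div_ne_zero (pow_ne_zero _ (norm_ne_zero_iff.2 hχ)) (pow_ne_zero _ (norm_ne_zero_iff.2 hβ))

lemma integrable_trace_inv_incrementDensity (hμ : ∀ i, 0 < μ i) (hs : ∀ i, 0 < s i)
    (hmin : Minimality μ s d f g) :
    Integrable (fun lam => ((incrementDensity μ s d f g lam)⁻¹).trace) freq := by
  refine hmin.2.congr ?_
  filter_upwards [ae_regular hμ hs hmin] with lam ⟨hβ, hχ, hp⟩
  rw [inv_incrementDensity hβ hχ hp]

lemma symbolP_ae_eq (hμ : ∀ i, 0 < μ i) (hs : ∀ i, 0 < s i) (hmin : Minimality μ s d f g) :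
    symbolP μ s d f g =ᵐ[freq] fun lam => ((incrementDensity μ s d f g lam)⁻¹)ᵀ := by
  filter_upwards [ae_regular hμ hs hmin] with lam ⟨hβ, hχ, hp⟩
  rw [inv_incrementDensity hβ hχ hp, Matrix.transpose_smul, symbolP]

lemma ofReal_norm_sq (z : ℂ) : ((‖z‖ ^ 2 : ℝ) : ℂ) = conj z * z := by
  rw [← Complex.normSq_eq_norm_sq, ← Complex.mul_conj, mul_comm]

lemma symbolT_ae_eq (hμ : ∀ i, 0 < μ i) (hs : ∀ i, 0 < s i) (hmin : Minimality μ s d f g) :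
    symbolT μ s d f g =ᵐ[freq] fun lam =>
      conj (chi μ s d lam) • (g lam * (incrementDensity μ s d f g lam)⁻¹)ᵀ := by
  filter_upwards [ae_regular hμ hs hmin] with lam ⟨hβ, hχ, hp⟩
  have hχ' : conj (chi μ s d lam) ≠ 0 := by simpa using hχ
  rw [inv_incrementDensity hβ hχ hp, symbolT, Matrix.mul_smul, Matrix.transpose_smul, smul_smul]
  congr 1
  rw [Complex.ofReal_div, ofReal_norm_sq (chi μ s d lam)]
  field_simp

/-- The function of the weighted space that has the covariances of `∫ xᵀ dZ_η` with the observed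
increments. -/
noncomputable def noiseSymbol (μ s d : Fin r → ℕ) (f g : ℝ → Matrix (Fin T) (Fin T) ℂ)
    (x : ℝ → Fin T → ℂ) (lam : ℝ) : Fin T → ℂ :=
  conj (chi μ s d lam) • (x lam ᵥ* (g lam * (incrementDensity μ s d f g lam)⁻¹))

lemma aemeasurable_noiseSymbol (hg : ∀ p q, AEMeasurable (fun lam => g lam p q) freq)
    (hw : ∀ p q, AEMeasurable (fun lam => incrementDensity μ s d f g lam p q) freq)
    {x : ℝ → Fin T → ℂ} (hx : AEMeasurable x freq) :
    AEMeasurable (noiseSymbol μ s d f g x) freq := by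
  have h1 : ∀ p q, AEMeasurable
      (fun lam => (g lam * (incrementDensity μ s d f g lam)⁻¹) p q) freq := by
    intro p q
    simp only [Matrix.mul_apply]
    exact Finset.aemeasurable_fun_sum _ fun k _ => (hg p k).mul (aemeasurable_inv_entry hw k q)
  have h2 : AEMeasurable (fun lam => conj (chi μ s d lam)) freq :=
    (Complex.continuous_conj.comp continuous_chi).aemeasurable
  exact h2.smul (aemeasurable_vecMul h1 hx)

/-- The projection of a functional of `η` has no larger norm than the functional itself. -/
lemma weightedNormSq_noiseSymbol_le (hχ : ∀ᵐ lam ∂freq, chi μ s d lam ≠ 0)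
    (hf : ∀ᵐ lam ∂freq,
      (((‖chi μ s d lam‖ ^ 2 / ‖beta s d lam‖ ^ 2 : ℝ) : ℂ) • f lam).PosSemidef)
    (hg : ∀ᵐ lam ∂freq, (g lam).PosSemidef)
    (hpos : ∀ᵐ lam ∂freq, (incrementDensity μ s d f g lam).PosDef) (x : ℝ → Fin T → ℂ) :
    weightedNormSq (incrementDensity μ s d f g) (noiseSymbol μ s d f g x) ≤
      weightedNormSq g x := by
  simp only [weightedNormSq_eq_lintegral_sesq]
  refine lintegral_mono_ae ?_
  filter_upwards [hχ, hf, hg, hpos] with lam h1 h2 h3 h4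
  refine ENNReal.ofReal_le_ofReal ?_
  have hb : 0 < ‖chi μ s d lam‖ ^ 2 := by positivity
  have h := re_sesq_mul_inv_le hb h2 h3 h4 (x lam)
  refine le_trans (le_of_eq ?_) h
  rw [noiseSymbol, sesq_smul_left, sesq_smul_right, Complex.conj_conj, ← mul_assoc,
    ← ofReal_norm_sq, Complex.re_ofReal_mul, incrementDensity]

lemma isProjectionSymbol_functional {Y : ℤ → Fin T → Ω → ℂ} {w : ℝ → Matrix (Fin T) (Fin T) ℂ}
    (h : HasSpectralDensity P Y w) (N : ℕ) (a : ℕ → Fin T → ℂ) :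
    IsProjectionSymbol P Y w (functional N a Y) (trigPoly (stack (N + 1) a)) where
  memLp := memLp_finsetSum _ fun k _ => memLp_finsetSum _ fun p _ => (h.memLp k p).const_mul _
  aemeasurable := aemeasurable_trigPoly _
  ne_top := weightedNormSq_trigPoly_ne_top h.integrable _
  covariance := fun j l =>
    covariance_functional (φ := fun lam p => w lam p l) h.memLp (h.memLp j l)
      (fun p => h.integrable p l) (fun k p => by
        have := h.covariance (k - j) j p l
        rwa [add_sub_cancel] at this) N a

lemma isProjectionSymbol_noise [IsFiniteMeasure P] (hμ : ∀ i, 0 < μ i) (hs : ∀ i, 0 < s i)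
    (hξ : HasIncrementSpectralDensity P μ s d ξ f) (hη : HasSpectralDensity P η g)
    (hξη : IncrementsUncorrelated P μ s d ξ η) (hmin : Minimality μ s d f g) (N : ℕ)
    (a : ℕ → Fin T → ℂ) :
    IsProjectionSymbol P (increment μ s d (ξ + η)) (incrementDensity μ s d f g)
      (functional N a η) (noiseSymbol μ s d f g (trigPoly (stack (N + 1) a))) := by
  have hζ := hasSpectralDensity_increment_add hξ hη hξη
  have hpos := posDef_incrementDensity hμ hs hmin hζ.posSemidef
  have hadd : ∀ m p ω, increment μ s d (ξ + η) m p ω =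
      increment μ s d ξ m p ω + increment μ s d η m p ω := by
    intro m p ω; rw [increment_add μ s d]; rfl
  have hηm := memLp_increment (μ := μ) (s := s) (d := d) hη.memLp
  refine ⟨memLp_finsetSum _ fun k _ => memLp_finsetSum _ fun p _ => (hη.memLp k p).const_mul _,
    aemeasurable_noiseSymbol (fun p q => (hη.integrable p q).1.aemeasurable)
      (fun p q => (hζ.integrable p q).1.aemeasurable) (aemeasurable_trigPoly _),
    ((weightedNormSq_noiseSymbol_le (chi_ne_zero hμ hs) hξ.posSemidef hη.posSemidef hpos _).trans_lt
      (weightedNormSq_trigPoly_ne_top hη.integrable _).lt_top).ne, fun j l => ?_⟩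
  have hcross : ∀ k p, ∫ ω, η k p ω * conj (increment μ s d (ξ + η) j l ω) ∂P =
      ∫ lam, expo (k - j) lam * conj (chi μ s d lam * g lam l p) ∂freq := by
    intro k p
    rw [integral_mul_conj_comm]
    simp only [hadd, add_mul]
    rw [integral_add (integrable_mul_conj (hξ.memLp j l) (hη.memLp k p))
      (integrable_mul_conj (hηm j l) (hη.memLp k p)), hξη, zero_add,
      covariance_increment_self hη, ← integral_conj]
    simp only [map_mul, conj_expo, neg_sub]
  rw [covariance_functional (φ := fun lam p => conj (chi μ s d lam * g lam l p)) hη.memLp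
    (hζ.memLp j l) (fun p => integrable_conj (integrable_chi_mul (hη.integrable l p))) hcross N a]
  refine integral_congr_ae ?_
  filter_upwards [hpos, hη.posSemidef] with lam h1 h2
  have hdet : IsUnit (incrementDensity μ s d f g lam).det :=
    (Matrix.isUnit_iff_isUnit_det _).1 h1.isUnit
  simp only [noiseSymbol]
  rw [Matrix.smul_vecMul, Matrix.vecMul_vecMul, Matrix.mul_assoc, Matrix.nonsing_inv_mul _ hdet,
    Matrix.mul_one, Pi.smul_apply, smul_eq_mul]
  simp only [dotProduct, Matrix.vecMul, Finset.mul_sum]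
  refine Finset.sum_congr rfl fun p _ => ?_
  have := h2.1.apply p l
  rw [← this, map_mul, RCLike.star_def]
  ring

lemma integrable_symbolT [IsFiniteMeasure P] (hμ : ∀ i, 0 < μ i) (hs : ∀ i, 0 < s i)
    (hξ : HasIncrementSpectralDensity P μ s d ξ f) (hη : HasSpectralDensity P η g)
    (hξη : IncrementsUncorrelated P μ s d ξ η) (hmin : Minimality μ s d f g) (p q : Fin T) :
    Integrable (fun lam => symbolT μ s d f g lam p q) freq := by
  have hζ := hasSpectralDensity_increment_add hξ hη hξη
  have hpos := posDef_incrementDensity hμ hs hmin hζ.posSemidef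
  have hfin : weightedNormSq g (fun _ => Pi.single q 1) ≠ ∞ := by
    refine ((weightedNormSq_le_of_bound (C := 1) fun lam l => ?_).trans_lt (ENNReal.mul_lt_top
      ENNReal.ofReal_lt_top (lintegral_sum_norm_entries_ne_top hη.integrable).lt_top)).ne
    rw [Pi.single_apply]
    split_ifs <;> simp
  refine (integrable_apply hpos hζ.integrable (integrable_trace_inv_incrementDensity hμ hs hmin)
    (aemeasurable_noiseSymbol (fun p q => (hη.integrable p q).1.aemeasurable)
      (fun p q => (hζ.integrable p q).1.aemeasurable) aemeasurable_const)
    ((weightedNormSq_noiseSymbol_le (chi_ne_zero hμ hs) hξ.posSemidef hη.posSemidef hpos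
      (fun _ => Pi.single q 1)).trans_lt hfin.lt_top).ne p).congr ?_
  filter_upwards [symbolT_ae_eq hμ hs hmin] with lam h
  simp only [h, noiseSymbol, Matrix.single_one_vecMul, Pi.smul_apply, Matrix.smul_apply,
    Matrix.transpose_apply, Matrix.row]

/-! ### From the weight of the increments to the weight of the observed sequence -/

/-- Spectral characteristics with respect to the measure of `ζ` and of its increments differ by the
factor `χ / β`. -/
lemma isSpectralCharacteristic_iff (hμ : ∀ i, 0 < μ i) (hs : ∀ i, 0 < s i)
    (h : HasSpectralDensity P (increment μ s d (ξ + η)) (incrementDensity μ s d f g))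
    (Z : Lp ℂ 2 P) (v : ℝ → Fin T → ℂ) :
    IsSpectralCharacteristic P μ s d (ξ + η) (obsDensity s d f g) Z v ↔
      IsSpectralImage h.memLp (incrementDensity μ s d f g) Z
        fun lam => (beta s d lam / chi μ s d lam) • v lam := by
  have hne : ∀ᵐ lam ∂freq, beta s d lam ≠ 0 ∧ chi μ s d lam ≠ 0 := by
    filter_upwards [beta_ne_zero (s := s) (d := d), chi_ne_zero (d := d) hμ hs] with lam h1 h2
    exact ⟨h1, h2⟩
  have hβm : AEMeasurable (beta s d) freq := continuous_beta.aemeasurable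
  have hχm : AEMeasurable (chi μ s d) freq := continuous_chi.aemeasurable
  refine and_congr ⟨fun hv => (hβm.div hχm).smul hv, fun hv => ?_⟩
    (forall_congr' fun ε => forall_congr' fun _ => exists_congr fun c => and_congr ?_ ?_)
  · refine ((hχm.div hβm).smul hv).congr ?_
    filter_upwards [hne] with lam ⟨h1, h2⟩
    simp only [Pi.smul_apply', Pi.div_apply, smul_smul]
    rw [div_mul_div_cancel₀ h1, div_self h2, one_smul]
  · have hEq : weightedNormSq (obsDensity s d f g) (fun lam => v lam - c.sum (fun x z =>
        Pi.single x.2 (z * expo x.1 lam * (chi μ s d lam / beta s d lam)))) =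
        weightedNormSq (incrementDensity μ s d f g)
          ((fun lam => (beta s d lam / chi μ s d lam) • v lam) - trig c) := by
      simp only [weightedNormSq_eq_lintegral_sesq]
      refine lintegral_congr_ae ?_
      filter_upwards [hne] with lam ⟨h1, h2⟩
      have hv : v lam - c.sum (fun x z =>
          Pi.single x.2 (z * expo x.1 lam * (chi μ s d lam / beta s d lam))) =
          (chi μ s d lam / beta s d lam) •
            (((fun lam => (beta s d lam / chi μ s d lam) • v lam) - trig c) lam) := by
        rw [Pi.sub_apply, smul_sub, smul_smul, div_mul_div_cancel₀ h1, div_self h2, one_smul,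
          trig_apply, Finsupp.sum, Finsupp.sum, Finset.smul_sum]
        congr 1
        refine Finset.sum_congr rfl fun x _ => ?_
        rw [← Pi.single_smul, smul_eq_mul, mul_comm]
      rw [hv, incrementDensity_eq_smul h1, sesq_smul_matrix, sesq_smul_left, sesq_smul_right,
        ← mul_assoc, Complex.ofReal_div, ofReal_norm_sq, ofReal_norm_sq, map_div₀]
      congr 3
      have h1' : conj (beta s d lam) ≠ 0 := by simpa using h1
      field_simp
    rw [hEq]
  · have hEq : eLpNorm (fun ω => Z ω - c.sum (fun x z =>
        z * increment μ s d (ξ + η) x.1 x.2 ω)) 2 P = ‖Z - combo h.memLp c‖ₑ := by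
      rw [Lp.enorm_def]
      refine eLpNorm_congr_ae ?_
      filter_upwards [Lp.coeFn_sub Z (combo h.memLp c), coeFn_combo h.memLp c] with ω h1 h2
      rw [h1, Pi.sub_apply, h2]
    rw [hEq]

lemma observedSpace_eq_spanOff (N : ℕ) (ζ : ℤ → Fin T → Ω → ℂ) :
    observedSpace P μ s d N ζ =
      spanOff P (increment μ s d ζ) (Finset.Ico 0 ((N + degree μ s d + 1 : ℕ) : ℤ)) := by
  have : ∀ k : ℤ, (k ≤ -1 ∨ (N : ℤ) + (degree μ s d : ℤ) + 1 ≤ k) ↔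
      k ∉ Finset.Ico 0 ((N + degree μ s d + 1 : ℕ) : ℤ) := by
    intro k
    rw [Finset.mem_Ico]
    push_cast
    omega
  simp only [observedSpace, spanOff, this]

/-- Optimal spectral characteristics of a random variable with known projection symbol. -/
lemma isOptimalSpectralCharacteristic_iff [IsFiniteMeasure P] (hμ : ∀ i, 0 < μ i)
    (hs : ∀ i, 0 < s i) (hξ : HasIncrementSpectralDensity P μ s d ξ f)
    (hη : HasSpectralDensity P η g) (hξη : IncrementsUncorrelated P μ s d ξ η)
    (hmin : Minimality μ s d f g) {N : ℕ} {X : Ω → ℂ} {v : ℝ → Fin T → ℂ}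
    (hX : IsProjectionSymbol P (increment μ s d (ξ + η)) (incrementDensity μ s d f g) X v)
    {c q : Fin (N + degree μ s d + 1) × Fin T → ℂ}
    (hq : ∀ x : Fin (N + degree μ s d + 1) × Fin T,
      ∫ lam, expo (-((x.1 : ℕ) : ℤ)) lam * v lam x.2 ∂freq = 2 * (Real.pi : ℂ) * q x)
    (hc : matP μ s d N f g *ᵥ c = q) {u : ℝ → Fin T → ℂ}
    (hu : ∀ᵐ lam ∂freq, (beta s d lam / chi μ s d lam) • u lam =
      v lam - trigPoly c lam ᵥ* (incrementDensity μ s d f g lam)⁻¹) (h : ℝ → Fin T → ℂ) :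
    IsOptimalSpectralCharacteristic P μ s d N ξ η f g X h ↔ h =ᵐ[freq] u := by
  have hζ := hasSpectralDensity_increment_add hξ hη hξη
  have hpos := posDef_incrementDensity hμ hs hmin hζ.posSemidef
  have hinv := integrable_trace_inv_incrementDensity hμ hs hmin
  rw [matP, fourierMatrix_congr (symbolP_ae_eq hμ hs hmin)] at hc
  have key := interpolation_iff hζ hpos hinv hX hq hc
    fun lam => (beta s d lam / chi μ s d lam) • h lam
  simp only [IsOptimalSpectralCharacteristic, IsOptimalEstimate, observedSpace_eq_spanOff,
    isSpectralCharacteristic_iff hμ hs hζ]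
  rw [key]
  constructor
  · intro hh
    filter_upwards [hh, hu, beta_ne_zero (s := s) (d := d), chi_ne_zero (d := d) hμ hs]
      with lam h1 h2 h3 h4
    exact smul_right_injective _ (div_ne_zero h3 h4) (h1.trans h2.symm)
  · intro hh
    filter_upwards [hh, hu] with lam h1 h2
    rw [h1, h2]

end Observed

/-! ### The explicit formulas -/

section Formulas

variable {r T : ℕ} {μ s d : Fin r → ℕ} {f g : ℝ → Matrix (Fin T) (Fin T) ℂ} {lam : ℝ}

lemma smul_termB (hβ : beta s d lam ≠ 0) (hχ : chi μ s d lam ≠ 0) (N : ℕ) (a : ℕ → Fin T → ℂ) :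
    (beta s d lam / chi μ s d lam) • termB μ s d N a lam =
      trigPoly (stack (N + 1) (bCoeff μ s d N a)) lam := by
  rw [termB, smul_smul, div_mul_div_cancel₀ hχ, div_self hβ, one_smul]

lemma smul_termA (hβ : beta s d lam ≠ 0) (hχ : chi μ s d lam ≠ 0)
    (hp : IsUnit (obsDensity s d f g lam)) (N : ℕ) (a : ℕ → Fin T → ℂ) :
    (beta s d lam / chi μ s d lam) • termA s d N a f g lam =
      noiseSymbol μ s d f g (trigPoly (stack (N + 1) a)) lam := by
  have hχ' : conj (chi μ s d lam) ≠ 0 := by simpa using hχ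
  rw [termA, noiseSymbol, inv_incrementDensity hβ hχ hp, Matrix.mul_smul, Matrix.vecMul_smul,
    smul_smul, smul_smul, Complex.ofReal_div, ofReal_norm_sq, ofReal_norm_sq]
  congr 1
  field_simp

lemma smul_termC (hβ : beta s d lam ≠ 0) (hχ : chi μ s d lam ≠ 0)
    (hp : IsUnit (obsDensity s d f g lam)) {K : ℕ} (c : Fin K × Fin T → ℂ) :
    (beta s d lam / chi μ s d lam) • termC μ s d f g c lam =
      trigPoly c lam ᵥ* (incrementDensity μ s d f g lam)⁻¹ := by
  rw [termC, inv_incrementDensity hβ hχ hp, Matrix.vecMul_smul, smul_smul, Complex.ofReal_div,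
    ofReal_norm_sq, ofReal_norm_sq]
  congr 1
  rw [div_mul_div_comm]
  ring

lemma symbolT_eq_smul_symbolT' (lam : ℝ) :
    symbolT μ s d f g lam = conj (chi μ s d lam) • symbolT' μ s d f g lam := by
  rw [symbolT, symbolT', smul_smul]
  congr 1
  rw [Complex.ofReal_div, ofReal_norm_sq (chi μ s d lam)]
  by_cases hχ : chi μ s d lam = 0
  · simp [hχ]
  · have hχ' : conj (chi μ s d lam) ≠ 0 := by simpa using hχ
    field_simp

lemma matT_mulVec_padded (hT : ∀ p q, Integrable (fun lam => symbolT μ s d f g lam p q) freq)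
    (hT' : ∀ p q, Integrable (fun lam => symbolT' μ s d f g lam p q) freq) (N : ℕ)
    (a : ℕ → Fin T → ℂ) :
    matT μ s d N f g *ᵥ padded N (degree μ s d) a =
      (-1 : ℂ) ^ (∑ i, d i) • matT' μ s d N f g *ᵥ
        stack (N + degree μ s d + 1) (aMu μ s d N a) := by
  refine eq_of_integral_mulVec_trigPoly hT _ _ fun x => ?_
  have key : ∀ lam, symbolT μ s d f g lam *ᵥ trigPoly (padded N (degree μ s d) a) lam =
      (-1 : ℂ) ^ (∑ i, d i) • symbolT' μ s d f g lam *ᵥ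
        trigPoly (stack (N + degree μ s d + 1) (aMu μ s d N a)) lam := by
    intro lam
    rw [symbolT_eq_smul_symbolT', trigPoly_padded, Matrix.smul_mulVec, ← Matrix.mulVec_smul,
      ← trigPoly_aMu, Matrix.mulVec_smul]
  have h := integral_expo_mul_mulVec_trigPoly hT'
    (stack (N + degree μ s d + 1) (aMu μ s d N a)) x
  simp only [key, Pi.smul_apply, smul_eq_mul, mul_left_comm _ ((-1 : ℂ) ^ (∑ i, d i))]
  rw [integral_const_mul, h, matT']

end Formulas

end GMInterpolation

theorem corollary2p1 {Ω : Type*} [MeasurableSpace Ω] (P : Measure Ω) [IsProbabilityMeasure P]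
    {r T : ℕ} (μ s d : Fin r → ℕ) (hμ : ∀ i, 0 < μ i) (hs : ∀ i, 0 < s i) (hd : ∀ i, 0 < d i)
    (N : ℕ) (a : ℕ → Fin T → ℂ) (ξ η : ℤ → Fin T → Ω → ℂ)
    (f g : ℝ → Matrix (Fin T) (Fin T) ℂ)
    (hξ : GMInterpolation.HasIncrementSpectralDensity P μ s d ξ f)
    (hη : GMInterpolation.HasSpectralDensity P η g)
    (hξη : GMInterpolation.IncrementsUncorrelated P μ s d ξ η)
    (hmin : GMInterpolation.Minimality μ s d f g) :
    -- the matrices in the formulas are well defined, and `P_N` is invertible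
    (∀ p q, Integrable (fun lam => GMInterpolation.symbolP μ s d f g lam p q)
      GMInterpolation.freq) ∧
    (∀ p q, Integrable (fun lam => GMInterpolation.symbolT μ s d f g lam p q)
      GMInterpolation.freq) ∧
    IsUnit (GMInterpolation.matP μ s d N f g) ∧
    -- `h = h¹ - h²`
    (∀ lam, GMInterpolation.charH μ s d N a f g lam =
      GMInterpolation.charH1 μ s d N a f g lam - GMInterpolation.charH2 μ s d N a f g lam) ∧
    -- `h` is the spectral characteristic of the optimal estimate of `H_N ξ`
    (∀ h : ℝ → Fin T → ℂ,
      GMInterpolation.IsOptimalSpectralCharacteristic P μ s d N ξ η f g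
        (GMInterpolation.functionalH μ s d N a ξ η) h ↔
      h =ᵐ[GMInterpolation.freq] GMInterpolation.charH μ s d N a f g) ∧
    -- `h¹` is the spectral characteristic of the optimal estimate of `B_N χ ζ`
    (∀ h : ℝ → Fin T → ℂ,
      GMInterpolation.IsOptimalSpectralCharacteristic P μ s d N ξ η f g
        (GMInterpolation.functionalB μ s d N a (ξ + η)) h ↔
      h =ᵐ[GMInterpolation.freq] GMInterpolation.charH1 μ s d N a f g) ∧
    -- `h²` is the spectral characteristic of the optimal estimate of `A_N η`
    (∀ h : ℝ → Fin T → ℂ,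
      GMInterpolation.IsOptimalSpectralCharacteristic P μ s d N ξ η f g
        (GMInterpolation.functional N a η) h ↔
      h =ᵐ[GMInterpolation.freq] GMInterpolation.charH2 μ s d N a f g) ∧
    -- the vector `T_N [a_N]_{+n}` through the coefficients `a_{μ,N}`, where these integrals exist
    ((∀ p q, Integrable (fun lam => GMInterpolation.symbolT' μ s d f g lam p q)
        GMInterpolation.freq) →
      Matrix.mulVec (GMInterpolation.matT μ s d N f g)
        (GMInterpolation.padded N (GMInterpolation.degree μ s d) a) =
      ((-1 : ℂ) ^ (∑ i, d i)) • Matrix.mulVec (GMInterpolation.matT' μ s d N f g)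
        (GMInterpolation.stack (N + GMInterpolation.degree μ s d + 1)
          (GMInterpolation.aMu μ s d N a))) := by
  have hζ := GMInterpolation.hasSpectralDensity_increment_add hξ hη hξη
  have hwm : ∀ p q, AEMeasurable
      (fun lam => GMInterpolation.incrementDensity μ s d f g lam p q) GMInterpolation.freq :=
    fun p q => (hζ.integrable p q).1.aemeasurable
  have hpos := GMInterpolation.posDef_incrementDensity hμ hs hmin hζ.posSemidef
  have hinv := GMInterpolation.integrable_trace_inv_incrementDensity hμ hs hmin
  have hinvI := GMInterpolation.integrable_inv_entry hwm hpos hinv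
  have hT := GMInterpolation.integrable_symbolT hμ hs hξ hη hξη hmin
  have hsymP := GMInterpolation.symbolP_ae_eq (f := f) (g := g) hμ hs hmin
  have hunit : IsUnit (GMInterpolation.matP μ s d N f g) := by
    rw [GMInterpolation.matP, GMInterpolation.fourierMatrix_congr hsymP]
    exact GMInterpolation.isUnit_fourierMatrix_transpose hinvI
      (hpos.mono fun _ h => h.inv) _
  have hdet := (Matrix.isUnit_iff_isUnit_det _).1 hunit
  have hB := GMInterpolation.isProjectionSymbol_functional hζ N
    (GMInterpolation.bCoeff μ s d N a)
  have hA := GMInterpolation.isProjectionSymbol_noise hμ hs hξ hη hξη hmin N a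
  have hc1 : GMInterpolation.matP μ s d N f g *ᵥ GMInterpolation.coeffC1 μ s d N a f g =
      GMInterpolation.padded N (GMInterpolation.degree μ s d)
        (GMInterpolation.bCoeff μ s d N a) := by
    rw [GMInterpolation.coeffC1, Matrix.mulVec_mulVec, Matrix.mul_nonsing_inv _ hdet,
      Matrix.one_mulVec]
  have hc2 : GMInterpolation.matP μ s d N f g *ᵥ GMInterpolation.coeffC2 μ s d N a f g =
      GMInterpolation.matT μ s d N f g *ᵥ
        GMInterpolation.padded N (GMInterpolation.degree μ s d) a := by
    rw [GMInterpolation.coeffC2, Matrix.mulVec_mulVec, Matrix.mul_nonsing_inv _ hdet,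
      Matrix.one_mulVec]
  have hqB := fun x : Fin (N + GMInterpolation.degree μ s d + 1) × Fin T =>
    GMInterpolation.integral_expo_mul_trigPoly (GMInterpolation.padded N
      (GMInterpolation.degree μ s d) (GMInterpolation.bCoeff μ s d N a)) x.1 x.2
  simp only [GMInterpolation.trigPoly_padded] at hqB
  have hqA := GMInterpolation.integral_expo_mul_mulVec_trigPoly hT
    (GMInterpolation.padded N (GMInterpolation.degree μ s d) a)
  have hqA' : ∀ x : Fin (N + GMInterpolation.degree μ s d + 1) × Fin T,
      ∫ lam, GMInterpolation.expo (-((x.1 : ℕ) : ℤ)) lam *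
        GMInterpolation.noiseSymbol μ s d f g (GMInterpolation.trigPoly
          (GMInterpolation.stack (N + 1) a)) lam x.2 ∂GMInterpolation.freq =
      2 * (Real.pi : ℂ) * (GMInterpolation.matT μ s d N f g *ᵥ
        GMInterpolation.padded N (GMInterpolation.degree μ s d) a) x := by
    intro x
    rw [GMInterpolation.matT, ← hqA x]
    refine integral_congr_ae ?_
    filter_upwards [GMInterpolation.symbolT_ae_eq (f := f) (g := g) hμ hs hmin] with lam hlam
    rw [hlam, Matrix.smul_mulVec, Matrix.mulVec_transpose, GMInterpolation.trigPoly_padded,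
      GMInterpolation.noiseSymbol]
  have hreg := GMInterpolation.ae_regular hμ hs hmin
  refine ⟨fun p q => ?_, hT, hunit, fun lam => ?_, ?_, ?_, ?_, fun hT' =>
    GMInterpolation.matT_mulVec_padded hT hT' N a⟩
  · exact (hinvI q p).congr (hsymP.mono fun lam hlam => by
      simp only [hlam, Matrix.transpose_apply])
  · simp only [GMInterpolation.charH, GMInterpolation.charH1, GMInterpolation.charH2,
      GMInterpolation.termC, GMInterpolation.trigPoly_sub, Pi.sub_apply, Matrix.sub_vecMul,
      smul_sub]
    abel
  · refine GMInterpolation.isOptimalSpectralCharacteristic_iff hμ hs hξ hη hξη hmin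
      (hB.sub hζ hA) (c := GMInterpolation.coeffC1 μ s d N a f g -
        GMInterpolation.coeffC2 μ s d N a f g) (fun x => ?_)
      (by rw [Matrix.mulVec_sub, hc1, hc2]) ?_
    · have h1 := GMInterpolation.integrable_apply hpos hζ.integrable hinv hB.aemeasurable
        hB.ne_top x.2
      have h2 := GMInterpolation.integrable_apply hpos hζ.integrable hinv hA.aemeasurable
        hA.ne_top x.2
      simp only [Pi.sub_apply, mul_sub]
      rw [integral_sub (GMInterpolation.integrable_expo_mul h1 _)
        (GMInterpolation.integrable_expo_mul h2 _), hqB, hqA']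
    · filter_upwards [hreg] with lam ⟨hβ, hχ, hp⟩
      rw [GMInterpolation.charH, smul_sub, smul_sub, GMInterpolation.smul_termB hβ hχ,
        GMInterpolation.smul_termA hβ hχ hp, GMInterpolation.smul_termC hβ hχ hp, Pi.sub_apply]
  · refine GMInterpolation.isOptimalSpectralCharacteristic_iff hμ hs hξ hη hξη hmin
      hB hqB hc1 ?_
    filter_upwards [hreg] with lam ⟨hβ, hχ, hp⟩
    rw [GMInterpolation.charH1, smul_sub, GMInterpolation.smul_termB hβ hχ,
      GMInterpolation.smul_termC hβ hχ hp]
  · refine GMInterpolation.isOptimalSpectralCharacteristic_iff hμ hs hξ hη hξη hmin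
      hA hqA' hc2 ?_
    filter_upwards [hreg] with lam ⟨hβ, hχ, hp⟩
    rw [GMInterpolation.charH2, smul_sub, GMInterpolation.smul_termA hβ hχ hp,
      GMInterpolation.smul_termC hβ hχ hp]
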